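/- Let $m\ge 1$, let $\Sigma$ be an oriented smooth $m$-dimensional manifold (without boundary), fix an orientation of $\mathbb{R}^{m+2}$, let $T>0$, and let $F:[0,T]\times\Sigma\to\mathbb{R}^{m+2}$ be a smooth family of immersions $F_t=F(t,\cdot)$. For each $t$ let $g_t$ be the metric on $\Sigma$ induced by $F_t$, let $A_t$ be the second fundamental form of $F_t$, with $A_t(u,v)$ the component of the second derivative of $F_t$ in the directions $u,v$ normal to $F_t$, and let $\mathbf{H}(F_t)=\operatorname{tr}_{g_t}A_t$ be its mean curvature vector. Let $J(F_t)$ be the rotation of the normal planes of $F_t$ by $\pi/2$ in the positive direction; that is, for a normal vector $\nu\neq 0$, $J\nu$ is normal, $J\nu\perp\nu$, $|J\nu|=|\nu|$, and $(dF_t(\varepsilon_1),\dots,dF_t(\varepsilon_m),\nu,J\nu)$ is a positively oriented basis of $\mathbb{R}^{m+2}$ for every oriented basis $(\varepsilon_i)$ of a tangent space of $\Sigma$. Suppose that $F$ solves the skew mean curvature flow $$\partial_t F=J(F)\,\mathbf{H}(F)\qquad\text{on }[0,T]\times\Sigma .$$ Let $G(m,2)$ be the Grassmannian of oriented $m$-dimensional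 subspaces of $\mathbb{R}^{m+2}$, realized as the submanifold of unit simple $m$-vectors $e_1\wedge\dots\wedge e_m$ in $\Lambda^m\mathbb{R}^{m+2}$, with the induced metric and its Levi-Civita connection $\tilde\nabla$. Let $\tilde J$ be the complex structure on $TG(m,2)$ given, at $\xi=e_1\wedge\dots\wedge e_m$ with $(e_1,\dots,e_m,\nu_1,\nu_2)$ a positively oriented orthonormal basis of $\mathbb{R}^{m+2}$, by $\tilde J E_{i1}=E_{i2}$ and $\tilde J E_{i2}=-E_{i1}$, where $E_{i\alpha}\in T_\xi G(m,2)$ is obtained from $e_1\wedge\dots\wedge e_m$ by replacing $e_i$ by $\nu_\alpha$. Then the Gauss map $\rho:[0,T]\times\Sigma\to G(m,2)$, which sends $(t,x)$ to the oriented plane $dF_t(T_x\Sigma)$, is smooth and solves the Schrödinger flow $$\partial_t\rho=\tilde J(\rho)\,\tau(\rho)\qquad\text{on }[0,T]\times\Sigma,$$ where $\tau(\rho)=\operatorname{tr}_{g_t}\tilde\nabla d\rho$ is the tension field of $\rho(t,\cdot):(\Sigma,g_t)\to G(m,2)$. Derivatives in $t$ at the ends of $[0,T]$ are one-sided. -/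

import Mathlib

open Set Topology Manifold ContDiff

noncomputable section

/-- Euclidean `n`-space `ℝⁿ`. -/
abbrev Euc (n : ℕ) : Type := EuclideanSpace ℝ (Fin n)

/-- The space `Λᵐ ℝ^(m+2)` of `m`-vectors, with the inner product induced from `ℝ^(m+2)`. -/
abbrev MVec (m : ℕ) : Type := ⋀[ℝ]^m (Euc (m + 2))

/-! ### Oriented manifolds -/

/-- An orientation of an `m`-dimensional manifold: an orientation of every tangent space that is
locally constant when read in the local trivializations of the tangent bundle (which are the ones
given by the charts). -/
structure ManifoldOrientation (m : ℕ) (S : Type*) [TopologicalSpace S]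
    [ChartedSpace (Euc m) S] [IsManifold (𝓡 m) ∞ S] where
  /-- The orientation of the tangent space at a point. -/
  at_point : ∀ x : S, Orientation ℝ (TangentSpace (𝓡 m) x) (Fin m)
  locally_constant : ∀ x₀ : S, ∃ o₀ : Orientation ℝ (Euc m) (Fin m), ∀ᶠ x in 𝓝 x₀,
    ∃ hx : x ∈ (trivializationAt (Euc m) (TangentSpace (𝓡 m) : S → Type _) x₀).baseSet,
      Orientation.map (Fin m)
        ((trivializationAt (Euc m) (TangentSpace (𝓡 m) : S → Type _)
          x₀).continuousLinearEquivAt ℝ x hx).toLinearEquiv (at_point x) = o₀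

/-! ### Local coordinates

All coordinate expressions at a point `x` are taken in the preferred chart at `x`. They are used
only to form tensorial quantities, which do not depend on the chart. -/

/-- The partial derivative `∂ᵢ h` of a function on `ℝᵐ`. -/
def coordDeriv {m : ℕ} {W : Type*} [NormedAddCommGroup W] [NormedSpace ℝ W] (i : Fin m)
    (h : Euc m → W) (y : Euc m) : W :=
  fderiv ℝ h y (EuclideanSpace.single i 1)

section Coordinates

variable {m : ℕ} {S : Type*} [TopologicalSpace S] [ChartedSpace (Euc m) S]

/-- The map `h` read in the chart at `x`. -/
def inChart {W : Type*} (x : S) (h : S → W) : Euc m → W :=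
  fun y => h ((extChartAt (𝓡 m) x).symm y)

/-- The coordinates of `x` in the chart at `x`. -/
def chartPt (x : S) : Euc m := extChartAt (𝓡 m) x x

/-- The `i`-th coordinate vector field of the chart at `x`, at the point with coordinates `y`. -/
def coordVec (x : S) (i : Fin m) (y : Euc m) :
    TangentSpace (𝓡 m) ((extChartAt (𝓡 m) x).symm y) :=
  mfderiv 𝓘(ℝ, Euc m) (𝓡 m) (extChartAt (𝓡 m) x).symm y (EuclideanSpace.single i 1)

/-- The differential of a map into a normed space. -/
def differential {W : Type*} [NormedAddCommGroup W] [NormedSpace ℝ W] (f : S → W) (x : S) :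
    TangentSpace (𝓡 m) x →L[ℝ] W :=
  mfderiv (𝓡 m) 𝓘(ℝ, W) f x

/-- The metric on `S` induced by a map `f` into a Euclidean space. -/
def inducedMetric {n : ℕ} (f : S → Euc n) (x : S) (u v : TangentSpace (𝓡 m) x) : ℝ :=
  inner ℝ (differential f x u) (differential f x v)

/-- The matrix `(g_ij)` of a metric in the chart at `x`, at the point with coordinates `y`. -/
def metricMatrix (g : ∀ x : S, TangentSpace (𝓡 m) x → TangentSpace (𝓡 m) x → ℝ) (x : S)
    (y : Euc m) : Matrix (Fin m) (Fin m) ℝ :=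
  Matrix.of fun i j => g _ (coordVec x i y) (coordVec x j y)

/-- The Christoffel symbols `Γᵏ_ij` of the Levi-Civita connection of `g`, at `x`, in the chart
at `x`. -/
def christoffel (g : ∀ x : S, TangentSpace (𝓡 m) x → TangentSpace (𝓡 m) x → ℝ) (x : S)
    (k i j : Fin m) : ℝ :=
  (1 / 2) * ∑ l, (metricMatrix g x (chartPt x))⁻¹ k l *
    (coordDeriv i (fun y => metricMatrix g x y j l) (chartPt x)
      + coordDeriv j (fun y => metricMatrix g x y i l) (chartPt x)
      - coordDeriv l (fun y => metricMatrix g x y i j) (chartPt x))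

/-! ### Immersed submanifolds of Euclidean space -/

/-- The tangent plane of the immersed submanifold at `f x`. -/
def tangentPlane {n : ℕ} (f : S → Euc n) (x : S) : Submodule ℝ (Euc n) :=
  LinearMap.range (differential (m := m) f x).toLinearMap

/-- The component `A_ij = (∂ᵢ ∂ⱼ f)^⊥` of the second fundamental form at `x`. -/
def secondFundamentalForm {n : ℕ} (f : S → Euc n) (x : S) (i j : Fin m) : Euc n :=
  (tangentPlane (m := m) f x)ᗮ.starProjection
    (coordDeriv i (fun y => coordDeriv j (inChart x f) y) (chartPt x))

/-- The mean curvature vector `H = tr_g A = g^ij A_ij`. -/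
def meanCurvature {n : ℕ} (f : S → Euc n) (x : S) : Euc n :=
  ∑ i : Fin m, ∑ j : Fin m,
    (metricMatrix (m := m) (inducedMetric f) x (chartPt x))⁻¹ i j • secondFundamentalForm f x i j

end Coordinates

/-! ### The oriented Grassmannian `G(m,2)` -/

/-- The Grassmannian of oriented `m`-planes in `ℝ^(m+2)`, as the set of unit simple `m`-vectors:
an oriented `m`-plane corresponds to `e₁ ∧ ⋯ ∧ eₘ`, for any oriented orthonormal basis `e`. -/
def grassmannian (m : ℕ) : Set (MVec m) :=
  {ξ | ∃ e : Fin m → Euc (m + 2), Orthonormal ℝ e ∧ exteriorPower.ιMulti ℝ m e = ξ}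

/-- The tangent space `T_ξ G ⊆ Λᵐ ℝ^(m+2)`, consisting of the velocities at `ξ` of smooth curves
in `G`. -/
def grassmannTangent {m : ℕ} (ξ : MVec m) : Submodule ℝ (MVec m) :=
  Submodule.span ℝ {v | ∃ (ε : ℝ) (η : ℝ → MVec m), 0 < ε ∧ ContDiffOn ℝ ∞ η (Ioo (-ε) ε) ∧
    (∀ t ∈ Ioo (-ε) ε, η t ∈ grassmannian m) ∧ η 0 = ξ ∧ HasDerivAt η v 0}

/-- An orthonormal basis `e₁, …, eₘ, ν₁, ν₂` of `ℝ^(m+2)` is adapted to the oriented plane `ξ` if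
it is positively oriented and `e₁, …, eₘ` is an oriented basis of `ξ`. Then `ν₁, ν₂` is an oriented
basis of `ξ^⊥`. -/
def IsAdapted {m : ℕ} (ornt : Orientation ℝ (Euc (m + 2)) (Fin (m + 2))) (ξ : MVec m)
    (b : OrthonormalBasis (Fin (m + 2)) ℝ (Euc (m + 2))) : Prop :=
  b.toBasis.orientation = ornt ∧ exteriorPower.ιMulti ℝ m (fun i => b (Fin.castAdd 2 i)) = ξ

/-- The basis vector `E_iα = e₁ ∧ ⋯ ∧ ν_α ∧ ⋯ ∧ eₘ` (`ν_α` in place of `eᵢ`) of `T_ξ G` for a frame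
adapted to `ξ`. -/
def frameE {m : ℕ} (b : OrthonormalBasis (Fin (m + 2)) ℝ (Euc (m + 2))) (i : Fin m) (α : Fin 2) :
    MVec m :=
  exteriorPower.ιMulti ℝ m
    (Function.update (fun j => b (Fin.castAdd 2 j)) i (b (Fin.natAdd m α)))

open Classical in
/-- The rotation `J` of the normal plane `ξ^⊥` by `π/2` in the positive direction: `J ν₁ = ν₂` and
`J ν₂ = -ν₁` in a frame adapted to `ξ` (the result does not depend on the frame). On `ξ` it is
extended by `0`. -/
def normalJ {m : ℕ} (ornt : Orientation ℝ (Euc (m + 2)) (Fin (m + 2))) (ξ : MVec m)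
    (w : Euc (m + 2)) : Euc (m + 2) :=
  if h : ∃ b, IsAdapted ornt ξ b then
    inner ℝ (h.choose (Fin.natAdd m 0)) w • h.choose (Fin.natAdd m 1)
      - inner ℝ (h.choose (Fin.natAdd m 1)) w • h.choose (Fin.natAdd m 0)
  else 0

open Classical in
/-- The complex structure of `T_ξ G`, which is `Id ⊗ J` on `ξ ⊗ ξ^⊥ ≅ T_ξ G`. So `E_i1 ↦ E_i2` and
`E_i2 ↦ -E_i1` in a frame adapted to `ξ` (the result does not depend on the frame). On the
orthogonal complement of `T_ξ G` it is extended by `0`. -/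
def grassmannJ {m : ℕ} (ornt : Orientation ℝ (Euc (m + 2)) (Fin (m + 2))) (ξ : MVec m)
    (X : MVec m) : MVec m :=
  if h : ∃ b, IsAdapted ornt ξ b then
    ∑ i : Fin m, (inner ℝ (frameE h.choose i 0) X • frameE h.choose i 1
      - inner ℝ (frameE h.choose i 1) X • frameE h.choose i 0)
  else 0

section Maps

variable {m : ℕ} {S : Type*} [TopologicalSpace S] [ChartedSpace (Euc m) S]

/-- The component `(∇dρ)(∂ᵢ, ∂ⱼ) = ∇_i (∂ⱼ ρ) - Γᵏ_ij ∂_k ρ` at `x` for a map `ρ` into the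
Grassmannian. The Grassmannian carries the metric induced from `Λᵐ ℝ^(m+2)`, so its Levi-Civita
connection is the tangential part of the flat connection; the `Γᵏ_ij` are those of `g`. -/
def grassmannHessian (g : ∀ x : S, TangentSpace (𝓡 m) x → TangentSpace (𝓡 m) x → ℝ)
    (ρ : S → MVec m) (x : S) (i j : Fin m) : MVec m :=
  (grassmannTangent (ρ x)).starProjection
      (coordDeriv i (fun y => coordDeriv j (inChart x ρ) y) (chartPt x))
    - ∑ k, christoffel g x k i j • coordDeriv k (inChart x ρ) (chartPt x)

/-- The tension field `τ(ρ) = tr_g ∇dρ` of a map `ρ : (S, g) → G(m,2)`. -/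
def tensionField (g : ∀ x : S, TangentSpace (𝓡 m) x → TangentSpace (𝓡 m) x → ℝ)
    (ρ : S → MVec m) (x : S) : MVec m :=
  ∑ i, ∑ j, (metricMatrix g x (chartPt x))⁻¹ i j • grassmannHessian g ρ x i j

variable [IsManifold (𝓡 m) ∞ S]

open Classical in
/-- The Gauss map of an immersion `f`: it sends `x` to the oriented plane `df(T_x S)`, that is to
`e₁ ∧ ⋯ ∧ eₘ`, where `eᵢ = df(εᵢ)` are orthonormal and `ε` is an oriented basis of `T_x S` (the
result does not depend on `ε`). -/
def gaussMap (o : ManifoldOrientation m S) (f : S → Euc (m + 2)) (x : S) : MVec m :=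
  if h : ∃ ε : Module.Basis (Fin m) ℝ (TangentSpace (𝓡 m) x),
      ε.orientation = o.at_point x ∧ Orthonormal ℝ (fun i => differential f x (ε i)) then
    exteriorPower.ιMulti ℝ m (fun i => differential f x (h.choose i))
  else 0

/-- `F` is a smooth family of immersions `S → ℝ^(m+2)`, parametrized by `t ∈ [0,T]`. -/
structure IsImmersionFamily (T : ℝ) (F : ℝ → S → Euc (m + 2)) : Prop where
  smooth : ContMDiffOn (𝓘(ℝ, ℝ).prod (𝓡 m)) 𝓘(ℝ, Euc (m + 2)) ∞
    (fun p : ℝ × S => F p.1 p.2) (Icc 0 T ×ˢ univ)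
  immersion : ∀ t ∈ Icc 0 T, ∀ x, Function.Injective (differential (m := m) (F t) x)

/-- The family `F` solves the skew mean curvature flow `∂_t F = J(F) H(F)` on `[0,T]`. The normal
plane at `F t x` is the orthogonal complement of the oriented tangent plane `gaussMap o (F t) x`.
Derivatives at the ends of `[0,T]` are one-sided. -/
def SolvesSMCF (ornt : Orientation ℝ (Euc (m + 2)) (Fin (m + 2))) (o : ManifoldOrientation m S)
    (T : ℝ) (F : ℝ → S → Euc (m + 2)) : Prop :=
  ∀ t ∈ Icc 0 T, ∀ x, HasDerivWithinAt (fun s => F s x)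
    (normalJ ornt (gaussMap o (F t) x) (meanCurvature (m := m) (F t) x)) (Icc 0 T) t

/-- The map `ρ : [0,T] × S → G(m,2)` is smooth and solves the Schrödinger flow
`∂_t ρ = J̃(ρ) τ(ρ)`, where the tension field at time `t` is taken with respect to the metric `g t`
on `S`. -/
structure SolvesSchrodingerFlow (ornt : Orientation ℝ (Euc (m + 2)) (Fin (m + 2))) (T : ℝ)
    (g : ℝ → ∀ x : S, TangentSpace (𝓡 m) x → TangentSpace (𝓡 m) x → ℝ)
    (ρ : ℝ → S → MVec m) : Prop where
  mem_grassmannian : ∀ t ∈ Icc 0 T, ∀ x, ρ t x ∈ grassmannian m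
  smooth : ContMDiffOn (𝓘(ℝ, ℝ).prod (𝓡 m)) 𝓘(ℝ, MVec m) ∞
    (fun p : ℝ × S => ρ p.1 p.2) (Icc 0 T ×ˢ univ)
  equation : ∀ t ∈ Icc 0 T, ∀ x, HasDerivWithinAt (fun s => ρ s x)
    (grassmannJ ornt (ρ t x) (tensionField (g t) (ρ t) x)) (Icc 0 T) t

end Maps

end

/-! Under the identification of `T_ξ G` with homomorphisms from the plane `ξ` to its normal plane,
the differential of the Gauss map is the second fundamental form. The Codazzi equations then turn
the tension field `τ(ρ)` into the normal derivative `∇^⊥ H`. When the immersion moves with normal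
velocity `V`, the tangent planes rotate with velocity `∇^⊥ V`. For `V = J H` this is `J ∇^⊥ H`,
because in codimension two `J` is parallel for the normal connection; and composition with `J` is
`J̃`. Hence `∂_t ρ = J̃ τ(ρ)`.

No moving frame is used. A frame `b` adapted to the plane at one point of space-time is frozen, and
the nearby planes `r` are measured against it by Cramer's rule (`wedge_cramer`): `⟨∂ᵢf, ν_α⟩⟨r, ξ⟩ =
∑ⱼ ⟨∂ᵢf, eⱼ⟩⟨r, E_jα⟩`. At the base point `⟨r, ξ⟩ = 1`, while `⟨r, E_jα⟩`, `⟨∂ᵢf, ν_α⟩` and the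
first derivatives of `⟨r, ξ⟩` vanish. Two space derivatives of this identity give the tension field
(`sum_frame_tension`). One time derivative, with mixed partials exchanged by
`coordDeriv_time_deriv`, gives the velocity of `ρ`. The invertible matrix `⟨∂ᵢf, eⱼ⟩` is then
cancelled from both results in `hasDerivWithinAt_gauss_of_flow`.

Three facts support the computation. The velocity of a curve in `G` is a combination of the `E_iα`
(`grassmannian_velocity`). The rotation satisfies `⟨J w, z⟩ = det (w, z, ξ)`, which is linear in `ξ`
and makes `J` differentiable and parallel (`inner_normalJ`, `inner_coordDeriv_normalJ`). Finally,
the flow near a point has to be read in one chart although the mean curvature at each point is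
defined in that point's own chart (`meanCurvature_chart_symm`), and the Gauss map is smooth because
it is the normalized wedge of the coordinate vectors up to a locally constant sign. -/

/-! ### Wedge products and Cramer's rule. -/

theorem inner_wedge_wedge {m : ℕ} (x y : Fin m → Euc (m + 2)) :
    inner ℝ (exteriorPower.ιMulti ℝ m x) (exteriorPower.ιMulti ℝ m y) =
      (Matrix.of fun i j => inner ℝ (x i) (y j)).det := by
  rw [exteriorPower.inner_ιMulti_ιMulti, ← Matrix.det_transpose]
  rfl

/-- In an orthonormal basis of simple vectors the coefficients of a wedge are determinants of inner
products. Continuity makes the wedge a continuous multilinear map, which can be differentiated. -/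
theorem continuous_wedge {m : ℕ} :
    Continuous fun v : Fin m → Euc (m + 2) => exteriorPower.ιMulti ℝ m v := by
  let B := (EuclideanSpace.basisFun (Fin (m + 2)) ℝ).exteriorPower m
  have h : (fun v : Fin m → Euc (m + 2) => exteriorPower.ιMulti ℝ m v) =
      fun v => ∑ s, (inner ℝ (B s) (exteriorPower.ιMulti ℝ m v) : ℝ) • B s := by
    funext v
    exact (B.sum_repr' _).symm
  rw [h]
  refine continuous_finsetSum _ fun s _ => ?_
  suffices hs : Continuous fun v => (inner ℝ (B s) (exteriorPower.ιMulti ℝ m v) : ℝ) by fun_prop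
  have hB : B s = exteriorPower.ιMulti_family ℝ m (EuclideanSpace.basisFun (Fin (m + 2)) ℝ) s := by
    have : B s = B.toBasis s := by simp
    rw [this, OrthonormalBasis.toBasis_exteriorPower, exteriorPower.coe_basis]
    simp
  rw [hB, exteriorPower.ιMulti_family]
  simp_rw [inner_wedge_wedge]
  refine Continuous.matrix_det ?_
  refine continuous_matrix fun i j => ?_
  simp only [Matrix.of_apply]
  fun_prop

/-- The map `v ↦ v₁ ∧ ⋯ ∧ vₘ` as a continuous multilinear map. -/
noncomputable def wedgeL (m : ℕ) :
    ContinuousMultilinearMap ℝ (fun _ : Fin m => Euc (m + 2)) (MVec m) where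
  toMultilinearMap := (exteriorPower.ιMulti ℝ m).toMultilinearMap
  cont := continuous_wedge

theorem wedgeL_apply {m : ℕ} (v : Fin m → Euc (m + 2)) :
    wedgeL m v = exteriorPower.ιMulti ℝ m v := rfl

/-- `⟨v, ν⟩⟨r, ξ⟩ = ∑ⱼ ⟨v, eⱼ⟩⟨r, Eⱼ⟩` for `v` in the plane of `r`, where `ξ = e₁ ∧ ⋯ ∧ eₘ` and
`Eⱼ` is `ξ` with `eⱼ` replaced by `ν`. -/
theorem wedge_cramer {m : ℕ} (a e : Fin m → Euc (m + 2)) (ν v : Euc (m + 2))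
    (hv : v ∈ Submodule.span ℝ (range a)) :
    inner ℝ v ν * inner ℝ (exteriorPower.ιMulti ℝ m a) (exteriorPower.ιMulti ℝ m e) =
      ∑ j, inner ℝ v (e j) * inner ℝ (exteriorPower.ιMulti ℝ m a)
        (exteriorPower.ιMulti ℝ m (Function.update e j ν)) := by
  induction hv using Submodule.span_induction with
  | mem x hx =>
    obtain ⟨i, rfl⟩ := hx
    -- Cramer's rule for the matrix `⟨aᵢ, eⱼ⟩` and the right-hand side `⟨aᵢ, ν⟩`: replacing column
    -- `j` by the right-hand side is the same as replacing `eⱼ` by `ν`.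
    have h := congrFun (Matrix.mulVec_cramer (Matrix.of fun i j => inner ℝ (a i) (e j))
      (fun i => inner ℝ (a i) ν)) i
    simp only [Matrix.mulVec, dotProduct, Matrix.of_apply, Pi.smul_apply, smul_eq_mul,
      Matrix.cramer_apply] at h
    rw [inner_wedge_wedge, mul_comm, ← h]
    refine Finset.sum_congr rfl fun j _ => ?_
    rw [inner_wedge_wedge]
    congr 2
    ext k l
    by_cases hl : l = j
    · subst hl; simp
    · simp [hl]
  | zero => simp
  | add x y _ _ hx hy =>
    simp only [inner_add_left, add_mul, hx, hy, Finset.sum_add_distrib]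
  | smul c x _ hx =>
    simp only [real_inner_smul_left, mul_assoc, hx, Finset.mul_sum]

/-- As functions of the rows of `X` both sides are alternating, so it suffices to compare them on
permutations of the standard basis. -/
theorem wedge_linear_combination {m : ℕ} (X : Matrix (Fin m) (Fin m) ℝ)
    (h : Fin m → Euc (m + 2)) :
    exteriorPower.ιMulti ℝ m (fun i => ∑ j, X i j • h j) =
      X.det • exteriorPower.ιMulti ℝ m h := by
  have key : (exteriorPower.ιMulti ℝ m).compLinearMap (Fintype.linearCombination ℝ h) =
      (LinearMap.toSpanSingleton ℝ (MVec m) (exteriorPower.ιMulti ℝ m h)).compAlternatingMap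
        (Pi.basisFun ℝ (Fin m)).det := by
    refine Module.Basis.ext_alternating (Pi.basisFun ℝ (Fin m)) fun v hv => ?_
    obtain ⟨σ, hσ⟩ : ∃ σ : Equiv.Perm (Fin m), ∀ i, σ i = v i :=
      ⟨Equiv.ofBijective v (Finite.injective_iff_bijective.1 hv), fun i => rfl⟩
    obtain rfl : ⇑σ = v := funext hσ
    have h1 : (fun i => (Pi.basisFun ℝ (Fin m)) (σ i)) = (Pi.basisFun ℝ (Fin m)) ∘ σ := rfl
    rw [h1, AlternatingMap.map_perm, AlternatingMap.map_perm]
    congr 1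
    simp only [AlternatingMap.compLinearMap_apply, LinearMap.compAlternatingMap_apply,
      Module.Basis.det_self, LinearMap.toSpanSingleton_apply, one_smul]
    congr 1
    funext i
    simp [Fintype.linearCombination_apply, Pi.single_apply]
  refine (DFunLike.congr_fun key fun i => X i).trans ?_
  rw [LinearMap.compAlternatingMap_apply, LinearMap.toSpanSingleton_apply, Pi.basisFun_det_apply]
  rfl

/-! ### Frames, and nearby planes as graphs. -/

section Frame

variable {m : ℕ} (b : OrthonormalBasis (Fin (m + 2)) ℝ (Euc (m + 2)))

theorem inner_frame_castAdd (i j : Fin m) :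
    inner ℝ (b (Fin.castAdd 2 i)) (b (Fin.castAdd 2 j)) = if i = j then (1 : ℝ) else 0 := by
  rw [orthonormal_iff_ite.1 b.orthonormal]
  simp

theorem inner_frame_castAdd_natAdd (i : Fin m) (α : Fin 2) :
    inner ℝ (b (Fin.castAdd 2 i)) (b (Fin.natAdd m α)) = (0 : ℝ) := by
  rw [orthonormal_iff_ite.1 b.orthonormal, if_neg]
  intro h
  have := congrArg Fin.val h
  simp at this
  omega

theorem inner_frame_natAdd_castAdd (i : Fin m) (α : Fin 2) :
    inner ℝ (b (Fin.natAdd m α)) (b (Fin.castAdd 2 i)) = (0 : ℝ) := by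
  rw [real_inner_comm, inner_frame_castAdd_natAdd]

theorem inner_frame_natAdd (α β : Fin 2) :
    inner ℝ (b (Fin.natAdd m α)) (b (Fin.natAdd m β)) = if α = β then (1 : ℝ) else 0 := by
  rw [orthonormal_iff_ite.1 b.orthonormal]
  simp

theorem sum_frame (v : Euc (m + 2)) :
    v = ∑ j : Fin m, (inner ℝ v (b (Fin.castAdd 2 j)) : ℝ) • b (Fin.castAdd 2 j) +
      ∑ α : Fin 2, (inner ℝ v (b (Fin.natAdd m α)) : ℝ) • b (Fin.natAdd m α) := by
  conv_lhs => rw [← b.sum_repr' v, Fin.sum_univ_add]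
  simp only [real_inner_comm]

theorem norm_wedge_frame :
    ‖exteriorPower.ιMulti ℝ m (fun i => b (Fin.castAdd 2 i))‖ = 1 := by
  have : inner ℝ (exteriorPower.ιMulti ℝ m (fun i => b (Fin.castAdd 2 i)))
      (exteriorPower.ιMulti ℝ m (fun i => b (Fin.castAdd 2 i))) = (1 : ℝ) := by
    rw [inner_wedge_wedge, ← Matrix.det_one (n := Fin m)]
    congr 1
    ext i j
    rw [Matrix.of_apply, inner_frame_castAdd, Matrix.one_apply]
  rw [real_inner_self_eq_norm_sq] at this
  exact (pow_eq_one_iff_of_nonneg (norm_nonneg _) two_ne_zero).1 this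

theorem norm_of_mem_grassmannian {r : MVec m} (hr : r ∈ grassmannian m) : ‖r‖ = 1 := by
  obtain ⟨e, he, rfl⟩ := hr
  have : inner ℝ (exteriorPower.ιMulti ℝ m e) (exteriorPower.ιMulti ℝ m e) = (1 : ℝ) := by
    rw [inner_wedge_wedge, ← Matrix.det_one (n := Fin m)]
    congr 1
    ext i j
    rw [Matrix.of_apply, orthonormal_iff_ite.1 he, Matrix.one_apply]
  rw [real_inner_self_eq_norm_sq] at this
  exact (pow_eq_one_iff_of_nonneg (norm_nonneg _) two_ne_zero).1 this

theorem inner_wedge_frameE (i : Fin m) (α : Fin 2) :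
    inner ℝ (exteriorPower.ιMulti ℝ m (fun i => b (Fin.castAdd 2 i))) (frameE b i α) =
      (0 : ℝ) := by
  rw [frameE, inner_wedge_wedge]
  apply Matrix.det_eq_zero_of_column_eq_zero i
  intro k
  simp [inner_frame_castAdd_natAdd]

/-- A simple `m`-vector near `ξ = e₁ ∧ ⋯ ∧ eₘ` is determined by its components along `ξ` and
the `E_iα`. -/
theorem wedge_eq_graph (a : Fin m → Euc (m + 2)) (ξ : MVec m)
    (hξ : exteriorPower.ιMulti ℝ m (fun i => b (Fin.castAdd 2 i)) = ξ)
    (hc : (inner ℝ (exteriorPower.ιMulti ℝ m a) ξ : ℝ) ≠ 0) :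
    exteriorPower.ιMulti ℝ m a = (inner ℝ (exteriorPower.ιMulti ℝ m a) ξ : ℝ) •
      exteriorPower.ιMulti ℝ m (fun i => b (Fin.castAdd 2 i) +
        ∑ α, ((inner ℝ (exteriorPower.ιMulti ℝ m a) ξ : ℝ)⁻¹ *
          inner ℝ (exteriorPower.ιMulti ℝ m a) (frameE b i α)) • b (Fin.natAdd m α)) := by
  subst hξ
  set r := exteriorPower.ιMulti ℝ m a with hr
  set ξ := exteriorPower.ιMulti ℝ m (fun i => b (Fin.castAdd 2 i)) with hξ
  have hdet : inner ℝ r ξ =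
      (Matrix.of fun i j => (inner ℝ (a i) (b (Fin.castAdd 2 j)) : ℝ)).det := by
    rw [hr, hξ, inner_wedge_wedge]
  -- The coefficient is the determinant of `⟨aᵢ, eⱼ⟩`, so it can be absorbed into the wedge as a
  -- linear change of the graph vectors. The new vectors turn out to be exactly the `aᵢ`.
  conv_rhs => arg 1; rw [hdet]
  rw [← wedge_linear_combination]
  conv_lhs => rw [hr]
  congr 1
  funext i
  conv_lhs => rw [sum_frame b (a i)]
  simp only [Matrix.of_apply, smul_add, Finset.sum_add_distrib]
  congr 1
  simp only [Finset.smul_sum]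
  rw [Finset.sum_comm]
  refine Finset.sum_congr rfl fun α _ => ?_
  simp only [smul_smul]
  rw [← Finset.sum_smul]
  congr 1
  -- The tangential parts agree by construction; for the normal parts, Cramer's rule identifies
  -- `⟨aᵢ, ν_α⟩` with the graph slopes applied to the tangential part of `aᵢ`.
  have h := wedge_cramer a (fun i => b (Fin.castAdd 2 i)) (b (Fin.natAdd m α)) (a i)
    (Submodule.subset_span ⟨i, rfl⟩)
  rw [← hr, ← hξ] at h
  rw [eq_comm, ← mul_left_inj' hc, h, Finset.sum_mul]
  refine Finset.sum_congr rfl fun j _ => ?_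
  rw [frameE]
  field_simp

end Frame

/-! ### Tangent vectors of the Grassmannian and the rotation of the normal plane. -/

section Frame

variable {m : ℕ} (b : OrthonormalBasis (Fin (m + 2)) ℝ (Euc (m + 2)))

theorem wedge_update_sum (e : Fin m → Euc (m + 2)) (i : Fin m) (c : Fin 2 → ℝ)
    (ν : Fin 2 → Euc (m + 2)) :
    exteriorPower.ιMulti ℝ m (Function.update e i (∑ α, c α • ν α)) =
      ∑ α, c α • exteriorPower.ιMulti ℝ m (Function.update e i (ν α)) := by
  rw [AlternatingMap.map_update_sum]
  simp only [AlternatingMap.map_update_smul]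

/-- The velocity of a curve in the Grassmannian at `ξ` is a combination of the `E_iα`. -/
theorem grassmannian_velocity {η : ℝ → MVec m} {η' ξ : MVec m} {s : Set ℝ} {t : ℝ} (ht : t ∈ s)
    (hs : UniqueDiffWithinAt ℝ s t) (hη : HasDerivWithinAt η η' s t)
    (hmem : ∀ u ∈ s, η u ∈ grassmannian m) (ht0 : η t = ξ)
    (hξ : exteriorPower.ιMulti ℝ m (fun i => b (Fin.castAdd 2 i)) = ξ) :
    inner ℝ η' ξ = (0 : ℝ) ∧
      η' = ∑ i, ∑ α, (inner ℝ η' (frameE b i α) : ℝ) • frameE b i α := by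
  have hnorm : inner ℝ ξ ξ = (1 : ℝ) := by
    rw [real_inner_self_eq_norm_sq, ← hξ, norm_wedge_frame]; norm_num
  have h0 : inner ℝ η' ξ = (0 : ℝ) := by
    have h1 : HasDerivWithinAt (fun u => (inner ℝ (η u) (η u) : ℝ))
        (inner ℝ (η t) η' + inner ℝ η' (η t)) s t := hη.inner ℝ hη
    have h2 : HasDerivWithinAt (fun u => (inner ℝ (η u) (η u) : ℝ)) 0 s t := by
      refine (hasDerivWithinAt_const t s (1 : ℝ)).congr (fun u hu => ?_) ?_
      · rw [real_inner_self_eq_norm_sq, norm_of_mem_grassmannian (hmem u hu)]; norm_num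
      · rw [ht0, hnorm]
    have h3 := hs.eq_deriv _ h1 h2
    rw [ht0, real_inner_comm η' ξ] at h3
    linarith
  refine ⟨h0, ?_⟩
  have hc : HasDerivWithinAt (fun u => (inner ℝ (η u) ξ : ℝ)) 0 s t := by
    have := hη.inner ℝ (hasDerivWithinAt_const t s ξ)
    simpa [h0] using this
  have hc0 : (inner ℝ (η t) ξ : ℝ) = 1 := by rw [ht0, hnorm]
  have hp (i : Fin m) (α : Fin 2) : HasDerivWithinAt
      (fun u => (inner ℝ (η u) (frameE b i α) : ℝ)) (inner ℝ η' (frameE b i α)) s t := by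
    have := hη.inner ℝ (hasDerivWithinAt_const t s (frameE b i α))
    simpa using this
  have hp0 (i : Fin m) (α : Fin 2) : (inner ℝ (η t) (frameE b i α) : ℝ) = 0 := by
    rw [ht0, ← hξ, inner_wedge_frameE]
  have hq (i : Fin m) (α : Fin 2) : HasDerivWithinAt
      (fun u => (inner ℝ (η u) ξ : ℝ)⁻¹ * inner ℝ (η u) (frameE b i α))
      (inner ℝ η' (frameE b i α)) s t := by
    have := (hc.fun_inv (by rw [hc0]; norm_num)).fun_mul (hp i α)
    simpa [hc0, hp0] using this
  -- A curve of `m`-vectors comes with no differentiable choice of bases. The graph vectors over the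
  -- fixed plane `ξ` supply one, with slopes read off from `η` itself.
  let h : ℝ → Fin m → Euc (m + 2) := fun u i => b (Fin.castAdd 2 i) +
    ∑ α, ((inner ℝ (η u) ξ : ℝ)⁻¹ * inner ℝ (η u) (frameE b i α)) • b (Fin.natAdd m α)
  let h' : Fin m → Euc (m + 2) := fun i =>
    ∑ α, (inner ℝ η' (frameE b i α) : ℝ) • b (Fin.natAdd m α)
  have hh : HasDerivWithinAt h h' s t := by
    rw [hasDerivWithinAt_pi]
    intro i
    refine HasDerivWithinAt.const_add _ (HasDerivWithinAt.fun_sum fun α _ => ?_)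
    exact (hq i α).smul_const _
  have hh0 : h t = fun i => b (Fin.castAdd 2 i) := by
    funext i
    simp [h, hp0]
  have hw : HasDerivWithinAt (fun u => wedgeL m (h u)) ((wedgeL m).linearDeriv (h t) h') s t :=
    ((wedgeL m).hasFDerivAt (h t)).comp_hasDerivWithinAt t hh
  have hg := hc.smul hw
  have heq : η =ᶠ[𝓝[s] t] fun u => (inner ℝ (η u) ξ : ℝ) • wedgeL m (h u) := by
    have : ∀ᶠ u in 𝓝[s] t, (inner ℝ (η u) ξ : ℝ) ≠ 0 :=
      hc.continuousWithinAt.eventually_ne (by simp only [hc0]; norm_num)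
    filter_upwards [this, self_mem_nhdsWithin] with u hu hus
    obtain ⟨a, -, ha⟩ := hmem u hus
    rw [wedgeL_apply]
    rw [← ha] at hu
    have := wedge_eq_graph b a ξ hξ hu
    rwa [ha] at this
  have hg' := hg.congr_of_eventuallyEq heq (heq.self_of_nhdsWithin ht)
  refine (hs.eq_deriv _ hη hg').trans ?_
  rw [hc0, zero_smul, add_zero, one_smul, ContinuousMultilinearMap.linearDeriv_apply]
  refine Finset.sum_congr rfl fun i _ => ?_
  rw [wedgeL_apply, hh0]
  simp only [frameE, h', wedge_update_sum]

/-- Rotating `eᵢ` towards `ν_α` while fixing the other `eⱼ` gives a curve of planes with this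
velocity. -/
theorem frameE_mem_grassmannTangent {ξ : MVec m}
    (hξ : exteriorPower.ιMulti ℝ m (fun i => b (Fin.castAdd 2 i)) = ξ) (i : Fin m) (α : Fin 2) :
    frameE b i α ∈ grassmannTangent ξ := by
  refine Submodule.subset_span ⟨1, fun t => Real.cos t • ξ + Real.sin t • frameE b i α,
    one_pos, ?_, fun t _ => ?_, by simp, ?_⟩
  · apply ContDiff.contDiffOn
    fun_prop
  · refine ⟨Function.update (fun j => b (Fin.castAdd 2 j)) i
      (Real.cos t • b (Fin.castAdd 2 i) + Real.sin t • b (Fin.natAdd m α)), ?_, ?_⟩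
    · rw [orthonormal_iff_ite]
      intro k l
      by_cases hk : k = i <;> by_cases hl : l = i
      · subst hk; subst hl
        simp only [Function.update_self, inner_add_left, inner_add_right, real_inner_smul_left,
          real_inner_smul_right, inner_frame_castAdd, inner_frame_natAdd,
          inner_frame_castAdd_natAdd, inner_frame_natAdd_castAdd]
        simp only [if_true, mul_one, mul_zero, add_zero, zero_add]
        linarith [Real.cos_sq_add_sin_sq t, sq (Real.cos t), sq (Real.sin t)]
      · subst hk
        simp [hl, inner_add_left, real_inner_smul_left, inner_frame_natAdd_castAdd, Ne.symm hl]
      · subst hl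
        simp [hk, inner_add_right, real_inner_smul_right, inner_frame_castAdd_natAdd]
      · simp [hk, hl, inner_frame_castAdd]
    · rw [AlternatingMap.map_update_add, AlternatingMap.map_update_smul,
        AlternatingMap.map_update_smul, Function.update_eq_self, hξ]
      rfl
  · have := ((Real.hasDerivAt_cos 0).smul_const ξ).fun_add
      ((Real.hasDerivAt_sin 0).smul_const (frameE b i α))
    simpa using this

/-- Since `grassmannJ` reads only the components along the `E_iα`, this removes the tangential
projection of the Levi-Civita connection from the computation. -/
theorem inner_frameE_starProjection {ξ : MVec m}
    (hξ : exteriorPower.ιMulti ℝ m (fun i => b (Fin.castAdd 2 i)) = ξ) (i : Fin m) (α : Fin 2)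
    (X : MVec m) :
    inner ℝ (frameE b i α) ((grassmannTangent ξ).starProjection X) =
      (inner ℝ (frameE b i α) X : ℝ) := by
  rw [← Submodule.inner_starProjection_left_eq_right,
    Submodule.starProjection_eq_self_iff.2 (frameE_mem_grassmannTangent b hξ i α)]

/-- The functional `v₁ ∧ ⋯ ∧ vₘ ↦ det (w, z, v₁, …, vₘ)`, in coordinates with respect to `b`. -/
noncomputable def frameDet (w z : Euc (m + 2)) : MVec m →ₗ[ℝ] ℝ :=
  exteriorPower.alternatingMapLinearEquiv ((b.toBasis.det.curryLeft w).curryLeft z)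

theorem frameDet_wedge (w z : Euc (m + 2)) (v : Fin m → Euc (m + 2)) :
    frameDet b w z (exteriorPower.ιMulti ℝ m v) =
      b.toBasis.det (Matrix.vecCons w (Matrix.vecCons z v)) := by
  rw [frameDet, exteriorPower.alternatingMapLinearEquiv_apply_ιMulti]
  rfl

/-- `frameDet` as a map that is linear in all its arguments. -/
noncomputable def frameDetL (r : MVec m) : Euc (m + 2) →ₗ[ℝ] Euc (m + 2) →ₗ[ℝ] ℝ :=
  LinearMap.mk₂ ℝ (fun w z => frameDet b w z r)
    (fun w w' z => by simp [frameDet])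
    (fun c w z => by simp [frameDet])
    (fun w z z' => by simp [frameDet])
    (fun c w z => by simp [frameDet])

theorem frameDetL_apply (r : MVec m) (w z : Euc (m + 2)) :
    frameDetL b r w z = frameDet b w z r := rfl

/-- Moving the two normal vectors to the front is the square of a cyclic permutation, hence even. -/
theorem det_rotate_frame :
    b.toBasis.det (Matrix.vecCons (b (Fin.natAdd m 0)) (Matrix.vecCons (b (Fin.natAdd m 1))
      (fun i => b (Fin.castAdd 2 i)))) = 1 := by
  set f : Fin (m + 2) → Euc (m + 2) := Matrix.vecCons (b (Fin.natAdd m 0))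
    (Matrix.vecCons (b (Fin.natAdd m 1)) (fun i => b (Fin.castAdd 2 i))) with hf
  have h1 : (f ∘ finRotate (m + 2)) ∘ finRotate (m + 2) = b := by
    funext i
    simp only [Function.comp_apply, finRotate_apply]
    refine Fin.addCases (fun j => ?_) (fun α => ?_) i
    · have : Fin.castAdd 2 j + 1 + 1 = j.succ.succ := by
        ext
        simp [Fin.val_add]
      rw [this]
      rfl
    · fin_cases α
      · have : Fin.natAdd m (0 : Fin 2) + 1 + 1 = 0 := by
          ext
          simp [Fin.val_add]
        simp only [Fin.zero_eta]
        rw [this]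
        rfl
      · have : Fin.natAdd m (1 : Fin 2) + 1 + 1 = 1 := by
          ext
          simp [Fin.val_add]
        simp only [Fin.mk_one]
        rw [this]
        rfl
  have h2 : b.toBasis.det ((f ∘ finRotate (m + 2)) ∘ finRotate (m + 2)) = 1 := by
    rw [h1, ← b.coe_toBasis, b.toBasis.det_self]
  rw [AlternatingMap.map_perm, AlternatingMap.map_perm, smul_smul, Int.units_mul_self,
    one_smul] at h2
  exact h2

/-- Both sides are bilinear in `w` and `z`, so they are compared on the frame. A tangential argument
repeats some `eᵢ`; two normal arguments give `0`, the rotated frame, or its transposition. -/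
theorem frameDet_frame (w z : Euc (m + 2)) :
    frameDet b w z (exteriorPower.ιMulti ℝ m (fun i => b (Fin.castAdd 2 i))) =
      inner ℝ (b (Fin.natAdd m 0)) w * inner ℝ (b (Fin.natAdd m 1)) z -
        inner ℝ (b (Fin.natAdd m 1)) w * inner ℝ (b (Fin.natAdd m 0)) z := by
  have key : frameDetL b (exteriorPower.ιMulti ℝ m (fun i => b (Fin.castAdd 2 i))) =
      LinearMap.mk₂ ℝ (fun w z => (inner ℝ (b (Fin.natAdd m 0)) w : ℝ) *
        inner ℝ (b (Fin.natAdd m 1)) z -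
        inner ℝ (b (Fin.natAdd m 1)) w * inner ℝ (b (Fin.natAdd m 0)) z)
        (fun _ _ _ => by simp only [inner_add_right]; ring)
        (fun _ _ _ => by simp only [real_inner_smul_right, smul_eq_mul]; ring)
        (fun _ _ _ => by simp only [inner_add_right]; ring)
        (fun _ _ _ => by simp only [real_inner_smul_right, smul_eq_mul]; ring) := by
    refine b.toBasis.ext fun p => b.toBasis.ext fun q => ?_
    rw [frameDetL_apply, frameDet_wedge, LinearMap.mk₂_apply, b.coe_toBasis]
    refine Fin.addCases (fun i => ?_) (fun α => ?_) p
    · rw [AlternatingMap.map_eq_zero_of_eq _ _ (i := 0) (j := i.succ.succ) rfl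
        (Fin.succ_ne_zero _).symm]
      simp [inner_frame_natAdd_castAdd]
    refine Fin.addCases (fun i => ?_) (fun β => ?_) q
    · rw [AlternatingMap.map_eq_zero_of_eq _ _ (i := 1) (j := i.succ.succ) rfl
        (by
          rw [← Fin.succ_zero_eq_one]
          exact fun h => Fin.succ_ne_zero i (Fin.succ_injective _ h).symm)]
      simp [inner_frame_natAdd_castAdd]
    have hdiag (α : Fin 2) : b.toBasis.det (Matrix.vecCons (b (Fin.natAdd m α))
        (Matrix.vecCons (b (Fin.natAdd m α)) fun i => b (Fin.castAdd 2 i))) = 0 :=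
      AlternatingMap.map_eq_zero_of_eq _ _ (i := 0) (j := 1) rfl (by simp)
    have hswap : b.toBasis.det (Matrix.vecCons (b (Fin.natAdd m 1))
        (Matrix.vecCons (b (Fin.natAdd m 0)) fun i => b (Fin.castAdd 2 i))) = -1 := by
      rw [← det_rotate_frame b, ← AlternatingMap.map_swap _ _ (i := 0) (j := 1) (by simp)]
      congr 1
      funext k
      refine Fin.cases ?_ (fun k => Fin.cases ?_ (fun k => ?_) k) k
      · simp
      · simp
      · have h1 : (k.succ.succ : Fin (m + 2)) ≠ 1 := by
          rw [← Fin.succ_zero_eq_one]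
          exact fun h => (Fin.succ_ne_zero k) (Fin.succ_injective _ h)
        simp only [Function.comp_apply]
        rw [Equiv.swap_apply_of_ne_of_ne (Fin.succ_ne_zero _) h1]
        rfl
    simp only [inner_frame_natAdd]
    fin_cases α <;> fin_cases β
    · simpa using hdiag 0
    · simpa using det_rotate_frame b
    · simpa using hswap
    · simpa using hdiag 1
  exact congrArg (fun L => L w z) key

/-- If three of its arguments are normal, `frameDet` vanishes. -/
theorem frameDet_frameE (i : Fin m) (α β γ : Fin 2) :
    frameDet b (b (Fin.natAdd m β)) (b (Fin.natAdd m γ)) (frameE b i α) = 0 := by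
  rw [frameE, frameDet_wedge]
  have h1i : (1 : Fin (m + 2)) ≠ i.succ.succ := by
    rw [← Fin.succ_zero_eq_one]
    exact fun h => (Fin.succ_ne_zero i) (Fin.succ_injective _ h).symm
  rcases eq_or_ne β γ with h | h
  · subst h
    exact AlternatingMap.map_eq_zero_of_eq _ _ (i := 0) (j := 1) rfl (by simp)
  rcases eq_or_ne α β with h' | h'
  · subst h'
    exact AlternatingMap.map_eq_zero_of_eq _ _ (i := 0) (j := i.succ.succ) (by simp)
      (Fin.succ_ne_zero _).symm
  · have : α = γ := by omega
    subst this
    refine AlternatingMap.map_eq_zero_of_eq _ _ (i := 1) (j := i.succ.succ) ?_ h1i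
    simp [Matrix.cons_val_one]

/-- Oriented orthonormal bases share one determinant, so the frame chosen in `normalJ` can be traded
for any fixed `b`. The right-hand side is linear in `ξ`, which allows `J` to be differentiated along
a family of planes. -/
theorem inner_normalJ {ornt : Orientation ℝ (Euc (m + 2)) (Fin (m + 2))}
    (hb : b.toBasis.orientation = ornt) {ξ : MVec m} (hξ : ∃ b', IsAdapted ornt ξ b')
    (w z : Euc (m + 2)) :
    inner ℝ (normalJ ornt ξ w) z = frameDet b w z ξ := by
  have h := hξ.choose_spec
  rw [normalJ, dif_pos hξ]
  have hdet : b.toBasis.det = hξ.choose.toBasis.det :=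
    (OrthonormalBasis.same_orientation_iff_det_eq_det (e := b) (f := hξ.choose)).2
      (hb.trans h.1.symm)
  have h2 : frameDet b w z ξ = frameDet hξ.choose w z ξ := by
    rw [frameDet, frameDet, hdet]
  rw [h2]
  generalize hξ.choose = b' at h
  rw [← h.2, frameDet_frame, inner_sub_left, real_inner_smul_left, real_inner_smul_left]

theorem exists_isAdapted (ornt : Orientation ℝ (Euc (m + 2)) (Fin (m + 2))) {ξ : MVec m}
    (hξ : ξ ∈ grassmannian m) : ∃ b, IsAdapted ornt ξ b := by
  obtain ⟨e, he, rfl⟩ := hξ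
  -- The two zero entries are placeholders: the extension to an orthonormal basis only keeps the
  -- values on the first `m` indices.
  let v : Fin (m + 2) → Euc (m + 2) := Fin.append e 0
  have hv : Orthonormal ℝ ((range (Fin.castAdd 2)).domRestrict v : _ → Euc (m + 2)) := by
    constructor
    · rintro ⟨_, i, rfl⟩
      simpa [v, Set.domRestrict] using he.1 i
    · rintro ⟨_, i, rfl⟩ ⟨_, j, rfl⟩ hij
      have : i ≠ j := fun h => hij (by rw [h])
      simpa [v, Set.domRestrict] using he.2 this
  obtain ⟨b, hb⟩ := hv.exists_orthonormalBasis_extension_of_card_eq (ι := Fin (m + 2))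
    (by simp)
  have hbe (i : Fin m) : b (Fin.castAdd 2 i) = e i := by
    rw [hb _ ⟨i, rfl⟩]
    simp [v]
  rcases b.toBasis.orientation_eq_or_eq_neg ornt with h | h
  · exact ⟨b, h.symm, by simp only [hbe]⟩
  -- With the wrong orientation, exchanging the two normal vectors corrects it and leaves `e₁ ∧ ⋯ ∧
  -- eₘ` unchanged.
  · let σ : Equiv.Perm (Fin (m + 2)) := Equiv.swap (Fin.natAdd m 0) (Fin.natAdd m 1)
    have hσ (i : Fin m) : σ (Fin.castAdd 2 i) = Fin.castAdd 2 i := by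
      apply Equiv.swap_apply_of_ne_of_ne
      · intro h; have := congrArg Fin.val h; simp at this; omega
      · intro h; have := congrArg Fin.val h; simp at this; omega
    refine ⟨b.reindex σ, ?_, ?_⟩
    · have h1 := (b.toBasis.orientation_eq_or_eq_neg (b.reindex σ).toBasis.orientation)
      rcases h1 with h1 | h1
      · exfalso
        rw [eq_comm, Module.Basis.orientation_eq_iff_det_pos] at h1
        have h2 : ((b.reindex σ).toBasis : Fin (m + 2) → Euc (m + 2)) = b.toBasis ∘ σ := by
          funext k
          simp [σ]
        rw [h2, AlternatingMap.map_perm, Module.Basis.det_self, Equiv.Perm.sign_swap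
          (by simp)] at h1
        norm_num at h1
      · rw [h1, h]
    · have h3 (i : Fin m) : σ.symm (Fin.castAdd 2 i) = Fin.castAdd 2 i := by
        rw [Equiv.symm_apply_eq, hσ]
      simp only [OrthonormalBasis.reindex_apply, h3, hbe]

end Frame

/-! ### Calculus of partial derivatives. -/

section CoordDeriv

variable {m : ℕ} {W : Type*} [NormedAddCommGroup W] [NormedSpace ℝ W] {U : Set (Euc m)}

theorem ContDiffOn.coordDeriv {h : Euc m → W} (hU : IsOpen U) (hh : ContDiffOn ℝ ∞ h U)
    (i : Fin m) : ContDiffOn ℝ ∞ (coordDeriv i h) U :=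
  (hh.fderiv_of_isOpen hU le_rfl).clm_apply contDiffOn_const

theorem ContDiffOn.differentiableAt_of_isOpen {h : Euc m → W} (hU : IsOpen U)
    (hh : ContDiffOn ℝ ∞ h U) {y : Euc m} (hy : y ∈ U) : DifferentiableAt ℝ h y :=
  (hh.differentiableOn (by simp)).differentiableAt (hU.mem_nhds hy)

theorem coordDeriv_congr (hU : IsOpen U) {h k : Euc m → W} (hk : ∀ y ∈ U, h y = k y) (i : Fin m)
    {y : Euc m} (hy : y ∈ U) : coordDeriv i h y = coordDeriv i k y := by
  have : h =ᶠ[𝓝 y] k := Filter.eventuallyEq_of_mem (hU.mem_nhds hy) hk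
  rw [coordDeriv, this.fderiv_eq, coordDeriv]

theorem coordDeriv_comm {h : Euc m → W} (hU : IsOpen U) (hh : ContDiffOn ℝ ∞ h U) {y : Euc m}
    (hy : y ∈ U) (i j : Fin m) :
    coordDeriv i (coordDeriv j h) y = coordDeriv j (coordDeriv i h) y := by
  have hd : DifferentiableAt ℝ (fderiv ℝ h) y :=
    ContDiffOn.differentiableAt_of_isOpen hU (hh.fderiv_of_isOpen hU le_rfl) hy
  have key (i j : Fin m) : coordDeriv i (coordDeriv j h) y =
      fderiv ℝ (fderiv ℝ h) y (EuclideanSpace.single i 1) (EuclideanSpace.single j 1) := by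
    unfold coordDeriv
    rw [fderiv_clm_apply hd (by fun_prop)]
    simp
  rw [key, key]
  have : IsSymmSndFDerivAt ℝ h y :=
    (hh.contDiffAt (hU.mem_nhds hy)).isSymmSndFDerivAt
      (by simpa using WithTop.coe_le_coe.2 (le_top (a := (2 : ℕ∞))))
  exact this _ _

theorem coordDeriv_inner_const {F : Type*} [NormedAddCommGroup F] [InnerProductSpace ℝ F]
    {h : Euc m → F} {y : Euc m} (hh : DifferentiableAt ℝ h y) (v : F) (i : Fin m) :
    coordDeriv i (fun y => (inner ℝ (h y) v : ℝ)) y = inner ℝ (coordDeriv i h y) v := by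
  unfold coordDeriv
  rw [fderiv_inner_apply ℝ hh (by fun_prop)]
  simp

theorem coordDeriv_inner {F : Type*} [NormedAddCommGroup F] [InnerProductSpace ℝ F]
    {h k : Euc m → F} {y : Euc m} (hh : DifferentiableAt ℝ h y) (hk : DifferentiableAt ℝ k y)
    (i : Fin m) :
    coordDeriv i (fun y => (inner ℝ (h y) (k y) : ℝ)) y =
      inner ℝ (coordDeriv i h y) (k y) + inner ℝ (h y) (coordDeriv i k y) := by
  unfold coordDeriv
  rw [fderiv_inner_apply ℝ hh hk, add_comm]

theorem coordDeriv_mul {h k : Euc m → ℝ} {y : Euc m} (hh : DifferentiableAt ℝ h y)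
    (hk : DifferentiableAt ℝ k y) (i : Fin m) :
    coordDeriv i (fun y => h y * k y) y =
      coordDeriv i h y * k y + h y * coordDeriv i k y := by
  unfold coordDeriv
  rw [fderiv_fun_mul hh hk]
  simp
  ring

theorem coordDeriv_smul {h : Euc m → ℝ} {k : Euc m → W} {y : Euc m} (hh : DifferentiableAt ℝ h y)
    (hk : DifferentiableAt ℝ k y) (i : Fin m) :
    coordDeriv i (fun y => h y • k y) y =
      coordDeriv i h y • k y + h y • coordDeriv i k y := by
  unfold coordDeriv
  rw [fderiv_fun_smul hh hk]
  simp [add_comm]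

theorem coordDeriv_add {h k : Euc m → W} {y : Euc m} (hh : DifferentiableAt ℝ h y)
    (hk : DifferentiableAt ℝ k y) (i : Fin m) :
    coordDeriv i (fun y => h y + k y) y = coordDeriv i h y + coordDeriv i k y := by
  unfold coordDeriv
  rw [fderiv_fun_add hh hk]
  rfl

theorem coordDeriv_sub {h k : Euc m → W} {y : Euc m} (hh : DifferentiableAt ℝ h y)
    (hk : DifferentiableAt ℝ k y) (i : Fin m) :
    coordDeriv i (fun y => h y - k y) y = coordDeriv i h y - coordDeriv i k y := by
  unfold coordDeriv
  rw [fderiv_fun_sub hh hk]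
  rfl

theorem coordDeriv_sum {ι : Type*} [Fintype ι] {h : ι → Euc m → W} {y : Euc m}
    (hh : ∀ a, DifferentiableAt ℝ (h a) y) (i : Fin m) :
    coordDeriv i (fun y => ∑ a, h a y) y = ∑ a, coordDeriv i (h a) y := by
  unfold coordDeriv
  rw [fderiv_fun_sum fun a _ => hh a]
  simp

theorem coordDeriv_const (c : W) (i : Fin m) (y : Euc m) :
    coordDeriv i (fun _ => c) y = 0 := by
  simp [coordDeriv]

theorem coordDeriv_coordDeriv_mul {h k : Euc m → ℝ} (hU : IsOpen U) (hh : ContDiffOn ℝ ∞ h U)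
    (hk : ContDiffOn ℝ ∞ k U) {y : Euc m} (hy : y ∈ U) (i j : Fin m) :
    coordDeriv i (coordDeriv j fun y => h y * k y) y =
      coordDeriv i (coordDeriv j h) y * k y + coordDeriv j h y * coordDeriv i k y +
        (coordDeriv i h y * coordDeriv j k y + h y * coordDeriv i (coordDeriv j k) y) := by
  have h0 (z) (hz : z ∈ U) := ContDiffOn.differentiableAt_of_isOpen hU hh hz
  have k0 (z) (hz : z ∈ U) := ContDiffOn.differentiableAt_of_isOpen hU hk hz
  have h1 := ContDiffOn.differentiableAt_of_isOpen hU (hh.coordDeriv hU j) hy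
  have k1 := ContDiffOn.differentiableAt_of_isOpen hU (hk.coordDeriv hU j) hy
  rw [coordDeriv_congr hU (fun z hz => coordDeriv_mul (h0 z hz) (k0 z hz) j) i hy,
    coordDeriv_add (h1.fun_mul (k0 y hy)) ((h0 y hy).fun_mul k1), coordDeriv_mul h1 (k0 y hy),
    coordDeriv_mul (h0 y hy) k1]

theorem coordDeriv_coordDeriv_sum {ι : Type*} [Fintype ι] {h : ι → Euc m → W} (hU : IsOpen U)
    (hh : ∀ a, ContDiffOn ℝ ∞ (h a) U) {y : Euc m} (hy : y ∈ U) (i j : Fin m) :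
    coordDeriv i (coordDeriv j fun y => ∑ a, h a y) y =
      ∑ a, coordDeriv i (coordDeriv j (h a)) y := by
  rw [coordDeriv_congr hU (fun z hz => coordDeriv_sum
      (fun a => ContDiffOn.differentiableAt_of_isOpen hU (hh a) hz) j) i hy,
    coordDeriv_sum fun a => ContDiffOn.differentiableAt_of_isOpen hU ((hh a).coordDeriv hU j) hy]

theorem coordDeriv_coordDeriv_inner_const {F : Type*} [NormedAddCommGroup F]
    [InnerProductSpace ℝ F] {h : Euc m → F} (hU : IsOpen U) (hh : ContDiffOn ℝ ∞ h U) {y : Euc m}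
    (hy : y ∈ U) (v : F) (i j : Fin m) :
    coordDeriv i (coordDeriv j fun y => (inner ℝ (h y) v : ℝ)) y =
      inner ℝ (coordDeriv i (coordDeriv j h) y) v := by
  rw [coordDeriv_congr hU (fun z hz => coordDeriv_inner_const
      (ContDiffOn.differentiableAt_of_isOpen hU hh hz) v j) i hy,
    coordDeriv_inner_const (ContDiffOn.differentiableAt_of_isOpen hU (hh.coordDeriv hU j) hy)]

end CoordDeriv

/-! ### Metric, Christoffel symbols and mean curvature of a parametrization. -/

section LocalGeometry

variable {m n : ℕ}

/-- The Gram matrix `⟨∂ᵢh, ∂ⱼh⟩` of a parametrization. -/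
noncomputable def gramMat (h : Euc m → Euc n) (y : Euc m) : Matrix (Fin m) (Fin m) ℝ :=
  Matrix.of fun i j => inner ℝ (coordDeriv i h y) (coordDeriv j h y)

/-- The coefficients of the tangential part of `∂ᵢ∂ⱼh`. -/
noncomputable def tangentCoeff (h : Euc m → Euc n) (y : Euc m) (k i j : Fin m) : ℝ :=
  ∑ l, (gramMat h y)⁻¹ k l * inner ℝ (coordDeriv i (coordDeriv j h) y) (coordDeriv l h y)

/-- The mean curvature vector of a parametrization. -/
noncomputable def meanCurv (h : Euc m → Euc n) (y : Euc m) : Euc n :=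
  ∑ i, ∑ j, (gramMat h y)⁻¹ i j • (coordDeriv i (coordDeriv j h) y -
    ∑ k, tangentCoeff h y k i j • coordDeriv k h y)

theorem gramMat_symm (h : Euc m → Euc n) (y : Euc m) : (gramMat h y).transpose = gramMat h y := by
  ext i j
  simp [gramMat, real_inner_comm]

theorem gramMat_inv_symm (h : Euc m → Euc n) (y : Euc m) (i j : Fin m) :
    (gramMat h y)⁻¹ i j = (gramMat h y)⁻¹ j i := by
  conv_lhs => rw [← gramMat_symm, ← Matrix.transpose_nonsing_inv, Matrix.transpose_apply]

variable {U : Set (Euc m)} {h : Euc m → Euc n}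

theorem contDiffOn_gramMat (hU : IsOpen U) (hh : ContDiffOn ℝ ∞ h U) (i j : Fin m) :
    ContDiffOn ℝ ∞ (fun y => gramMat h y i j) U :=
  (hh.coordDeriv hU i).inner ℝ (hh.coordDeriv hU j)

theorem ContDiffOn.matrix_det {E : Type*} [NormedAddCommGroup E] [NormedSpace ℝ E] {s : Set E}
    {A : E → Matrix (Fin m) (Fin m) ℝ} (hA : ∀ i j, ContDiffOn ℝ ∞ (fun y => A y i j) s) :
    ContDiffOn ℝ ∞ (fun y => (A y).det) s := by
  simp only [Matrix.det_apply]
  refine ContDiffOn.sum fun σ _ => ContDiffOn.const_smul _ ?_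
  exact contDiffOn_prod fun i _ => hA _ _

/-- The entries of the inverse are cofactors divided by the determinant, and both are polynomial in
the entries of `A`. -/
theorem contDiffOn_matrix_inv {E : Type*} [NormedAddCommGroup E] [NormedSpace ℝ E] {s : Set E}
    {A : E → Matrix (Fin m) (Fin m) ℝ} (hA : ∀ i j, ContDiffOn ℝ ∞ (fun y => A y i j) s)
    (hdet : ∀ y ∈ s, (A y).det ≠ 0) (i j : Fin m) :
    ContDiffOn ℝ ∞ (fun y => (A y)⁻¹ i j) s := by
  have h1 : (fun y => (A y)⁻¹ i j) = fun y => (A y).det⁻¹ *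
      ((A y).updateRow j (Pi.single i 1)).det := by
    funext y
    rw [Matrix.inv_def, Ring.inverse_eq_inv', Matrix.smul_apply, Matrix.adjugate_apply,
      smul_eq_mul]
  rw [h1]
  refine ((ContDiffOn.matrix_det hA).inv hdet).mul (ContDiffOn.matrix_det fun k l => ?_)
  by_cases hk : k = j
  · subst hk
    simpa using contDiffOn_const
  · simpa [Matrix.updateRow_ne hk] using hA k l

theorem contDiffOn_gramMat_inv (hU : IsOpen U) (hh : ContDiffOn ℝ ∞ h U)
    (hdet : ∀ y ∈ U, (gramMat h y).det ≠ 0) (i j : Fin m) :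
    ContDiffOn ℝ ∞ (fun y => (gramMat h y)⁻¹ i j) U :=
  contDiffOn_matrix_inv (contDiffOn_gramMat hU hh) hdet i j

theorem contDiffOn_tangentCoeff (hU : IsOpen U) (hh : ContDiffOn ℝ ∞ h U)
    (hdet : ∀ y ∈ U, (gramMat h y).det ≠ 0) (k i j : Fin m) :
    ContDiffOn ℝ ∞ (fun y => tangentCoeff h y k i j) U :=
  ContDiffOn.sum fun l _ => (contDiffOn_gramMat_inv hU hh hdet k l).mul
    (((hh.coordDeriv hU j).coordDeriv hU i).inner ℝ (hh.coordDeriv hU l))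

theorem contDiffOn_meanCurv (hU : IsOpen U) (hh : ContDiffOn ℝ ∞ h U)
    (hdet : ∀ y ∈ U, (gramMat h y).det ≠ 0) : ContDiffOn ℝ ∞ (meanCurv h) U :=
  ContDiffOn.sum fun i _ => ContDiffOn.sum fun j _ =>
    (contDiffOn_gramMat_inv hU hh hdet i j).smul
      (((hh.coordDeriv hU j).coordDeriv hU i).sub (ContDiffOn.sum fun k _ =>
        (contDiffOn_tangentCoeff hU hh hdet k i j).smul (hh.coordDeriv hU k)))

theorem sum_gramMat_mul_inv {y : Euc m} (hdet : (gramMat h y).det ≠ 0) (i k : Fin m) :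
    ∑ j, gramMat h y i j * (gramMat h y)⁻¹ j k = if i = k then 1 else 0 := by
  rw [← Matrix.mul_apply, Matrix.mul_nonsing_inv _ (isUnit_iff_ne_zero.2 hdet), Matrix.one_apply]

theorem sum_inv_mul_gramMat {y : Euc m} (hdet : (gramMat h y).det ≠ 0) (i k : Fin m) :
    ∑ j, (gramMat h y)⁻¹ i j * gramMat h y j k = if i = k then 1 else 0 := by
  rw [← Matrix.mul_apply, Matrix.nonsing_inv_mul _ (isUnit_iff_ne_zero.2 hdet), Matrix.one_apply]

/-- `∂ᵢ∂ⱼh` minus its tangential part is normal. -/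
theorem inner_normal_part {y : Euc m} (hdet : (gramMat h y).det ≠ 0) (i j l : Fin m) :
    inner ℝ (coordDeriv i (coordDeriv j h) y - ∑ k, tangentCoeff h y k i j • coordDeriv k h y)
      (coordDeriv l h y) = (0 : ℝ) := by
  rw [inner_sub_left, sum_inner, sub_eq_zero]
  simp only [real_inner_smul_left, tangentCoeff, Finset.sum_mul]
  rw [Finset.sum_comm]
  have (p k : Fin m) : (gramMat h y)⁻¹ k p * inner ℝ (coordDeriv i (coordDeriv j h) y)
      (coordDeriv p h y) * inner ℝ (coordDeriv k h y) (coordDeriv l h y) =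
      inner ℝ (coordDeriv i (coordDeriv j h) y) (coordDeriv p h y) *
        ((gramMat h y)⁻¹ p k * gramMat h y k l) := by
    rw [gramMat_inv_symm h y k p]
    simp only [gramMat, Matrix.of_apply]
    ring
  simp only [this, ← Finset.mul_sum, sum_inv_mul_gramMat hdet]
  simp

theorem inner_meanCurv {y : Euc m} (hdet : (gramMat h y).det ≠ 0) (l : Fin m) :
    inner ℝ (meanCurv h y) (coordDeriv l h y) = (0 : ℝ) := by
  simp only [meanCurv, sum_inner, real_inner_smul_left, inner_normal_part hdet, mul_zero,
    Finset.sum_const_zero]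

theorem tangentCoeff_symm (hU : IsOpen U) (hh : ContDiffOn ℝ ∞ h U) {y : Euc m} (hy : y ∈ U)
    (k i j : Fin m) : tangentCoeff h y k i j = tangentCoeff h y k j i := by
  simp only [tangentCoeff, coordDeriv_comm hU hh hy i j]

theorem coordDeriv_gramMat (hU : IsOpen U) (hh : ContDiffOn ℝ ∞ h U) {y : Euc m} (hy : y ∈ U)
    (c i j : Fin m) : coordDeriv c (fun y => gramMat h y i j) y =
      inner ℝ (coordDeriv c (coordDeriv i h) y) (coordDeriv j h y) +
        inner ℝ (coordDeriv i h y) (coordDeriv c (coordDeriv j h) y) :=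
  coordDeriv_inner (ContDiffOn.differentiableAt_of_isOpen hU (hh.coordDeriv hU i) hy)
    (ContDiffOn.differentiableAt_of_isOpen hU (hh.coordDeriv hU j) hy) c

theorem sum_inner_mul_inv (y : Euc m) (c p l : Fin m) :
    ∑ q, inner ℝ (coordDeriv c (coordDeriv p h) y) (coordDeriv q h y) * (gramMat h y)⁻¹ q l =
      tangentCoeff h y l c p := by
  simp only [tangentCoeff]
  exact Finset.sum_congr rfl fun q _ => by rw [gramMat_inv_symm h y q l, mul_comm]

/-- This is metric compatibility, `∇g⁻¹ = 0`, obtained by differentiating `g g⁻¹ = 1` and solving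
for the derivative of `g⁻¹`. -/
theorem coordDeriv_gramMat_inv (hU : IsOpen U) (hh : ContDiffOn ℝ ∞ h U)
    (hdet : ∀ y ∈ U, (gramMat h y).det ≠ 0) {y : Euc m} (hy : y ∈ U) (c k l : Fin m) :
    coordDeriv c (fun y => (gramMat h y)⁻¹ k l) y =
      -∑ p, (gramMat h y)⁻¹ k p * tangentCoeff h y l c p -
        ∑ p, (gramMat h y)⁻¹ p l * tangentCoeff h y k c p := by
  have hg (i j) := ContDiffOn.differentiableAt_of_isOpen hU (contDiffOn_gramMat hU hh i j) hy
  have hgi (i j) :=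
    ContDiffOn.differentiableAt_of_isOpen hU (contDiffOn_gramMat_inv hU hh hdet i j) hy
  have h1 (p : Fin m) : ∑ q, coordDeriv c (fun y => gramMat h y p q) y * (gramMat h y)⁻¹ q l +
      ∑ q, gramMat h y p q * coordDeriv c (fun y => (gramMat h y)⁻¹ q l) y = 0 := by
    have h2 := coordDeriv_congr hU (fun z hz => sum_gramMat_mul_inv (hdet z hz) p l) c hy
    rw [coordDeriv_const, coordDeriv_sum fun q => (hg p q).fun_mul (hgi q l)] at h2
    rw [← Finset.sum_add_distrib, ← h2]
    exact Finset.sum_congr rfl fun q _ => (coordDeriv_mul (hg p q) (hgi q l) c).symm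
  have h3 : ∑ p, (gramMat h y)⁻¹ k p *
      ∑ q, gramMat h y p q * coordDeriv c (fun y => (gramMat h y)⁻¹ q l) y =
      coordDeriv c (fun y => (gramMat h y)⁻¹ k l) y := by
    simp only [Finset.mul_sum]
    rw [Finset.sum_comm]
    simp only [← mul_assoc, ← Finset.sum_mul, sum_inv_mul_gramMat (hdet y hy)]
    simp
  rw [← h3]
  have h4 (p : Fin m) : ∑ q, gramMat h y p q * coordDeriv c (fun y => (gramMat h y)⁻¹ q l) y =
      -(tangentCoeff h y l c p + ∑ q, inner ℝ (coordDeriv c (coordDeriv q h) y)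
        (coordDeriv p h y) * (gramMat h y)⁻¹ q l) := by
    rw [eq_neg_of_add_eq_zero_right (h1 p)]
    simp only [coordDeriv_gramMat hU hh hy, add_mul, Finset.sum_add_distrib, sum_inner_mul_inv,
      real_inner_comm]
  simp only [h4, mul_neg, mul_add, Finset.sum_neg_distrib, Finset.sum_add_distrib,
    Finset.mul_sum, neg_add]
  rw [← sub_eq_add_neg]
  congr 1
  rw [Finset.sum_comm]
  refine Finset.sum_congr rfl fun q _ => ?_
  rw [tangentCoeff, Finset.mul_sum]
  exact Finset.sum_congr rfl fun p _ => by ring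

end LocalGeometry

/-! ### The tension field of the Gauss map. -/

section GaussHessian

variable {m : ℕ} (b : OrthonormalBasis (Fin (m + 2)) ℝ (Euc (m + 2))) {U : Set (Euc m)}
  {h : Euc m → Euc (m + 2)} {y : Euc m}

theorem inner_eq_sum_of_normal {v w : Euc (m + 2)}
    (hv : ∀ α : Fin 2, inner ℝ v (b (Fin.natAdd m α)) = (0 : ℝ)) :
    (inner ℝ w v : ℝ) =
      ∑ j : Fin m, inner ℝ w (b (Fin.castAdd 2 j)) * inner ℝ v (b (Fin.castAdd 2 j)) := by
  conv_lhs => rw [sum_frame b v]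
  simp [hv, inner_sum, real_inner_smul_right, mul_comm]

/-- The matrix `⟨∂ᵢh, eⱼ⟩`. -/
noncomputable def frameMat (h : Euc m → Euc (m + 2)) (y : Euc m) : Matrix (Fin m) (Fin m) ℝ :=
  Matrix.of fun i j => inner ℝ (coordDeriv i h y) (b (Fin.castAdd 2 j))

theorem frameMat_mul_transpose
    (hn : ∀ (i : Fin m) (α : Fin 2),
      inner ℝ (coordDeriv i h y) (b (Fin.natAdd m α)) = (0 : ℝ)) :
    frameMat b h y * (frameMat b h y).transpose = gramMat h y := by
  ext i j
  rw [Matrix.mul_apply, gramMat, Matrix.of_apply, inner_eq_sum_of_normal b (hn j)]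
  rfl

theorem frameMat_det_ne_zero (hdet : (gramMat h y).det ≠ 0)
    (hn : ∀ (i : Fin m) (α : Fin 2),
      inner ℝ (coordDeriv i h y) (b (Fin.natAdd m α)) = (0 : ℝ)) :
    (frameMat b h y).det ≠ 0 := by
  rw [← frameMat_mul_transpose b hn, Matrix.det_mul] at hdet
  exact left_ne_zero_of_mul hdet

/-- Subtracting the `Γ`-terms from `∂ₖ∂ᵢh` leaves a vector orthogonal to every `∂_l h`. These span
the plane of the `eⱼ`, so its components along the `eⱼ` vanish. -/
theorem inner_coordDeriv2_frame (hdet : (gramMat h y).det ≠ 0)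
    (hn : ∀ (i : Fin m) (α : Fin 2),
      inner ℝ (coordDeriv i h y) (b (Fin.natAdd m α)) = (0 : ℝ)) (k i j : Fin m) :
    (inner ℝ (coordDeriv k (coordDeriv i h) y) (b (Fin.castAdd 2 j)) : ℝ) =
      ∑ c, tangentCoeff h y c k i * inner ℝ (coordDeriv c h y) (b (Fin.castAdd 2 j)) := by
  set w := coordDeriv k (coordDeriv i h) y - ∑ c, tangentCoeff h y c k i • coordDeriv c h y
    with hw
  have h1 : (frameMat b h y).mulVec (fun j => inner ℝ w (b (Fin.castAdd 2 j))) = 0 := by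
    funext l
    have := inner_normal_part hdet k i l
    rw [inner_eq_sum_of_normal b (hn l)] at this
    simp only [Matrix.mulVec, dotProduct, frameMat, Matrix.of_apply, Pi.zero_apply]
    rw [← this]
    exact Finset.sum_congr rfl fun j _ => mul_comm _ _
  have h2 := congrFun (Matrix.eq_zero_of_mulVec_eq_zero (frameMat_det_ne_zero b hdet hn) h1) j
  simp only [Pi.zero_apply, hw, inner_sub_left, sum_inner, real_inner_smul_left] at h2
  linarith

/-- The normal component of `∂_c H`. -/
theorem inner_coordDeriv_meanCurv (hU : IsOpen U) (hh : ContDiffOn ℝ ∞ h U)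
    (hdet : ∀ y ∈ U, (gramMat h y).det ≠ 0) (hy : y ∈ U) {ν : Euc (m + 2)}
    (hn : ∀ i : Fin m, inner ℝ (coordDeriv i h y) ν = (0 : ℝ)) (c : Fin m) :
    (inner ℝ (coordDeriv c (meanCurv h) y) ν : ℝ) =
      ∑ k, ∑ l, ((-∑ p, (gramMat h y)⁻¹ k p * tangentCoeff h y l c p -
        ∑ p, (gramMat h y)⁻¹ p l * tangentCoeff h y k c p) *
          inner ℝ (coordDeriv k (coordDeriv l h) y) ν +
        (gramMat h y)⁻¹ k l * (inner ℝ (coordDeriv c (coordDeriv k (coordDeriv l h)) y) ν -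
          ∑ d, tangentCoeff h y d k l * inner ℝ (coordDeriv c (coordDeriv d h) y) ν)) := by
  have hg (i j) :=
    ContDiffOn.differentiableAt_of_isOpen hU (contDiffOn_gramMat_inv hU hh hdet i j) hy
  have ht (d i j) :=
    ContDiffOn.differentiableAt_of_isOpen hU (contDiffOn_tangentCoeff hU hh hdet d i j) hy
  have h1 (i) := ContDiffOn.differentiableAt_of_isOpen hU (hh.coordDeriv hU i) hy
  have h2 (i j) :=
    ContDiffOn.differentiableAt_of_isOpen hU ((hh.coordDeriv hU j).coordDeriv hU i) hy
  have hs (k l) : DifferentiableAt ℝ (fun y => ∑ d, tangentCoeff h y d k l • coordDeriv d h y) y :=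
    DifferentiableAt.fun_sum fun d _ => (ht d k l).fun_smul (h1 d)
  unfold meanCurv
  rw [coordDeriv_sum fun k => DifferentiableAt.fun_sum fun l _ =>
    (hg k l).fun_smul ((h2 k l).fun_sub (hs k l)), sum_inner]
  refine Finset.sum_congr rfl fun k _ => ?_
  rw [coordDeriv_sum fun l => (hg k l).fun_smul ((h2 k l).fun_sub (hs k l)), sum_inner]
  refine Finset.sum_congr rfl fun l _ => ?_
  rw [coordDeriv_smul (hg k l) ((h2 k l).fun_sub (hs k l)), coordDeriv_sub (h2 k l) (hs k l),
    coordDeriv_sum fun d => (ht d k l).fun_smul (h1 d),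
    coordDeriv_gramMat_inv hU hh hdet hy]
  simp only [coordDeriv_smul (ht _ k l) (h1 _)]
  simp only [inner_add_left, inner_sub_left, sum_inner, real_inner_smul_left, hn, mul_zero,
    zero_add, Finset.sum_const_zero, sub_zero]

theorem inner_coordDeriv_of_mem_grassmannian {r : Euc m → MVec m} (hU : IsOpen U) (hr : ContDiffOn ℝ ∞ r U)
    (hmem : ∀ y ∈ U, r y ∈ grassmannian m) (hy : y ∈ U) (k : Fin m) :
    inner ℝ (coordDeriv k r y) (r y) = (0 : ℝ) := by
  have h1 := coordDeriv_congr hU (h := fun z => (inner ℝ (r z) (r z) : ℝ)) (k := fun _ => 1)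
    (fun z hz => by rw [real_inner_self_eq_norm_sq, norm_of_mem_grassmannian (hmem z hz)]; norm_num)
    k hy
  have hd := ContDiffOn.differentiableAt_of_isOpen hU hr hy
  rw [coordDeriv_const, coordDeriv_inner hd hd, real_inner_comm (coordDeriv k r y)] at h1
  linarith

/-- The tension field of the Gauss map is the normal derivative of the mean curvature vector. -/
theorem sum_frame_tension {r : Euc m → MVec m} (hU : IsOpen U) (hh : ContDiffOn ℝ ∞ h U)
    (hdet : ∀ y ∈ U, (gramMat h y).det ≠ 0) (hr : ContDiffOn ℝ ∞ r U)
    (hmem : ∀ y ∈ U, r y ∈ grassmannian m) (hy : y ∈ U)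
    (hξ : exteriorPower.ιMulti ℝ m (fun i => b (Fin.castAdd 2 i)) = r y)
    (hP : ∀ z ∈ U, ∀ (i : Fin m) (α : Fin 2),
      inner ℝ (coordDeriv i h z) (b (Fin.natAdd m α)) * inner ℝ (r z) (r y) =
        ∑ j : Fin m, inner ℝ (coordDeriv i h z) (b (Fin.castAdd 2 j)) *
          (inner ℝ (r z) (frameE b j α) : ℝ)) (α : Fin 2) (c : Fin m) :
    ∑ j, inner ℝ (coordDeriv c h y) (b (Fin.castAdd 2 j)) * ∑ k, ∑ l, (gramMat h y)⁻¹ k l *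
        (inner ℝ (coordDeriv k (coordDeriv l r) y) (frameE b j α) -
          ∑ d, tangentCoeff h y d k l * inner ℝ (coordDeriv d r y) (frameE b j α)) =
      (inner ℝ (coordDeriv c (meanCurv h) y) (b (Fin.natAdd m α)) : ℝ) := by
  have hrr : inner ℝ (r y) (r y) = (1 : ℝ) := by
    rw [real_inner_self_eq_norm_sq, norm_of_mem_grassmannian (hmem y hy)]; norm_num
  have hrE (j : Fin m) (α : Fin 2) : inner ℝ (r y) (frameE b j α) = (0 : ℝ) := by
    rw [← hξ, inner_wedge_frameE]
  have hn (i : Fin m) (α : Fin 2) :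
      inner ℝ (coordDeriv i h y) (b (Fin.natAdd m α)) = (0 : ℝ) := by
    have := hP y hy i α
    rw [hrr, mul_one] at this
    simpa [hrE] using this
  have hcd {F : Type} [NormedAddCommGroup F] [InnerProductSpace ℝ F] {f : Euc m → F}
      (hf : ContDiffOn ℝ ∞ f U) (v : F) : ContDiffOn ℝ ∞ (fun z => (inner ℝ (f z) v : ℝ)) U :=
    hf.inner ℝ contDiffOn_const
  have hda {F : Type} [NormedAddCommGroup F] [InnerProductSpace ℝ F] {f : Euc m → F}
      (hf : ContDiffOn ℝ ∞ f U) : DifferentiableAt ℝ f y :=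
    ContDiffOn.differentiableAt_of_isOpen hU hf hy
  have hc0 (k : Fin m) : inner ℝ (coordDeriv k r y) (r y) = (0 : ℝ) :=
    inner_coordDeriv_of_mem_grassmannian hU hr hmem hy k
  -- One derivative of the frozen-frame identity `hP`: at `y` the second fundamental form is the
  -- differential of `r`.
  have first (k i : Fin m) : (inner ℝ (coordDeriv k (coordDeriv i h) y) (b (Fin.natAdd m α)) : ℝ) =
      ∑ j, inner ℝ (coordDeriv i h y) (b (Fin.castAdd 2 j)) *
        inner ℝ (coordDeriv k r y) (frameE b j α) := by
    have h1 := coordDeriv_congr hU (fun z hz => hP z hz i α) k hy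
    rw [coordDeriv_mul (hda (hcd (hh.coordDeriv hU i) _)) (hda (hcd hr _)),
      coordDeriv_sum fun j => (hda (hcd (hh.coordDeriv hU i) _)).fun_mul (hda (hcd hr _)),
      coordDeriv_inner_const (hda (hh.coordDeriv hU i)), hn, hrr] at h1
    simp only [coordDeriv_mul (hda (hcd (hh.coordDeriv hU i) _)) (hda (hcd hr _)),
      coordDeriv_inner_const (hda hr), hrE] at h1
    simpa using h1
  have second (k l i : Fin m) :
      (inner ℝ (coordDeriv k (coordDeriv l (coordDeriv i h)) y) (b (Fin.natAdd m α)) : ℝ) =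
      ∑ j, (inner ℝ (coordDeriv l (coordDeriv i h) y) (b (Fin.castAdd 2 j)) *
          inner ℝ (coordDeriv k r y) (frameE b j α) +
        (inner ℝ (coordDeriv k (coordDeriv i h) y) (b (Fin.castAdd 2 j)) *
          inner ℝ (coordDeriv l r y) (frameE b j α) +
        inner ℝ (coordDeriv i h y) (b (Fin.castAdd 2 j)) *
          inner ℝ (coordDeriv k (coordDeriv l r) y) (frameE b j α))) := by
    have h1 := coordDeriv_congr hU (fun w hw => coordDeriv_congr hU
      (fun z hz => hP z hz i α) l hw) k hy
    have e1 := coordDeriv_coordDeriv_mul hU (hcd (hh.coordDeriv hU i) (b (Fin.natAdd m α)))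
      (hcd hr (r y)) hy k l
    have e2 := coordDeriv_coordDeriv_sum hU (fun j => (hcd (hh.coordDeriv hU i)
      (b (Fin.castAdd 2 j))).mul (hcd hr (frameE b j α))) hy k l
    have e3 (j : Fin m) := coordDeriv_coordDeriv_mul hU
      (hcd (hh.coordDeriv hU i) (b (Fin.castAdd 2 j))) (hcd hr (frameE b j α)) hy k l
    -- The second derivative of `⟨r, ξ⟩` need not vanish, but it is multiplied by `⟨∂ᵢh, ν_α⟩ = 0`;
    -- the first derivatives vanish because `r` has unit length.
    rw [coordDeriv_coordDeriv_inner_const hU (hh.coordDeriv hU i) hy,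
      coordDeriv_inner_const (hda hr), coordDeriv_inner_const (hda hr), hn, hrr, hc0, hc0] at e1
    simp only [coordDeriv_coordDeriv_inner_const hU (hh.coordDeriv hU i) hy,
      coordDeriv_coordDeriv_inner_const hU hr hy, coordDeriv_inner_const (hda hr),
      coordDeriv_inner_const (hda (hh.coordDeriv hU i)), hrE] at e3
    have e4 := e1.symm.trans (h1.trans (e2.trans (Finset.sum_congr rfl fun j _ => e3 j)))
    simpa using e4
  have tang (k l i : Fin m) : ∑ j, (inner ℝ (coordDeriv l (coordDeriv i h) y)
      (b (Fin.castAdd 2 j)) : ℝ) * inner ℝ (coordDeriv k r y) (frameE b j α) =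
      ∑ d, tangentCoeff h y d l i *
        inner ℝ (coordDeriv k (coordDeriv d h) y) (b (Fin.natAdd m α)) := by
    simp only [inner_coordDeriv2_frame b (hdet y hy) hn, first, Finset.sum_mul, Finset.mul_sum]
    rw [Finset.sum_comm]
    simp only [mul_assoc]
  -- Contracting the Hessian of `r` with `⟨∂_c h, eⱼ⟩` expresses it by third derivatives of `h` and
  -- one `Γ`-correction for each of the three indices, as in the covariant derivative of `A`.
  have hess (k l : Fin m) : ∑ j, inner ℝ (coordDeriv c h y) (b (Fin.castAdd 2 j)) *
      (inner ℝ (coordDeriv k (coordDeriv l r) y) (frameE b j α) -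
        ∑ d, tangentCoeff h y d k l * inner ℝ (coordDeriv d r y) (frameE b j α)) =
      inner ℝ (coordDeriv k (coordDeriv l (coordDeriv c h)) y) (b (Fin.natAdd m α)) -
      ∑ d, tangentCoeff h y d l c *
        inner ℝ (coordDeriv k (coordDeriv d h) y) (b (Fin.natAdd m α)) -
      ∑ d, tangentCoeff h y d k c *
        inner ℝ (coordDeriv l (coordDeriv d h) y) (b (Fin.natAdd m α)) -
      ∑ d, tangentCoeff h y d k l *
        (inner ℝ (coordDeriv d (coordDeriv c h) y) (b (Fin.natAdd m α)) : ℝ) := by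
    rw [second, Finset.sum_add_distrib, Finset.sum_add_distrib, tang, tang]
    have : ∑ d, tangentCoeff h y d k l *
        (inner ℝ (coordDeriv d (coordDeriv c h) y) (b (Fin.natAdd m α)) : ℝ) =
        ∑ j, inner ℝ (coordDeriv c h y) (b (Fin.castAdd 2 j)) *
          ∑ d, tangentCoeff h y d k l * inner ℝ (coordDeriv d r y) (frameE b j α) := by
      simp only [first, Finset.mul_sum]
      rw [Finset.sum_comm]
      exact Finset.sum_congr rfl fun j _ => Finset.sum_congr rfl fun d _ => by ring
    rw [this]
    simp only [mul_sub, Finset.sum_sub_distrib]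
    ring
  have lhs : ∑ j, inner ℝ (coordDeriv c h y) (b (Fin.castAdd 2 j)) *
      ∑ k, ∑ l, (gramMat h y)⁻¹ k l *
        (inner ℝ (coordDeriv k (coordDeriv l r) y) (frameE b j α) -
          ∑ d, tangentCoeff h y d k l * inner ℝ (coordDeriv d r y) (frameE b j α)) =
      ∑ k, ∑ l, (gramMat h y)⁻¹ k l *
        ∑ j, inner ℝ (coordDeriv c h y) (b (Fin.castAdd 2 j)) *
      ((inner ℝ (coordDeriv k (coordDeriv l r) y) (frameE b j α) : ℝ) -
        ∑ d, tangentCoeff h y d k l * inner ℝ (coordDeriv d r y) (frameE b j α)) := by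
    rw [Finset.sum_congr rfl fun j _ => Finset.mul_sum _ _ _, Finset.sum_comm]
    refine Finset.sum_congr rfl fun k _ => ?_
    rw [Finset.sum_congr rfl fun j _ => Finset.mul_sum _ _ _, Finset.sum_comm]
    refine Finset.sum_congr rfl fun l _ => ?_
    rw [Finset.mul_sum]
    refine Finset.sum_congr rfl fun j _ => ?_
    ring
  rw [lhs]
  simp only [hess]
  rw [inner_coordDeriv_meanCurv hU hh hdet hy (fun i => hn i α) c]
  -- Symmetry of the third derivatives plays the part of the Codazzi equations.
  have third (k l : Fin m) : coordDeriv c (coordDeriv k (coordDeriv l h)) y =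
      coordDeriv k (coordDeriv l (coordDeriv c h)) y := by
    rw [coordDeriv_comm hU (hh.coordDeriv hU l) hy c k]
    exact coordDeriv_congr hU (fun z hz => coordDeriv_comm hU hh hz c l) k hy
  simp only [third, coordDeriv_comm hU hh hy _ c]
  set a : Fin m → Fin m → ℝ := fun k l =>
    inner ℝ (coordDeriv k (coordDeriv l h) y) (b (Fin.natAdd m α)) with ha
  have asymm (k l : Fin m) : a k l = a l k := by
    simp only [ha, coordDeriv_comm hU hh hy k l]
  set G := (gramMat h y)⁻¹ with hG
  set Γ := tangentCoeff h y with hΓ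
  have Γsymm (k i j : Fin m) : Γ k i j = Γ k j i := tangentCoeff_symm hU hh hy k i j
  -- `t1` and `t2` match two of the three `Γ`-corrections in `hess` with the two terms of the
  -- derivative of `g⁻¹`. The third correction is the tangential part subtracted in `meanCurv`.
  have t1 : ∑ k, ∑ l, G k l * ∑ d, Γ d l c * a k d = ∑ k, ∑ l, (∑ p, G k p * Γ l c p) * a k l := by
    refine Finset.sum_congr rfl fun k _ => ?_
    simp only [Finset.mul_sum, Finset.sum_mul]
    rw [Finset.sum_comm]
    refine Finset.sum_congr rfl fun l _ => Finset.sum_congr rfl fun p _ => ?_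
    rw [Γsymm l c p, mul_assoc]
  have t2 : ∑ k, ∑ l, G k l * ∑ d, Γ d k c * a l d = ∑ k, ∑ l, (∑ p, G p l * Γ k c p) * a k l := by
    rw [Finset.sum_comm]
    conv_rhs => rw [Finset.sum_comm]
    refine Finset.sum_congr rfl fun l _ => ?_
    simp only [Finset.mul_sum, Finset.sum_mul]
    rw [Finset.sum_comm]
    refine Finset.sum_congr rfl fun k _ => Finset.sum_congr rfl fun p _ => ?_
    rw [Γsymm k c p, asymm k l, mul_assoc]
  simp only [mul_sub, Finset.sum_sub_distrib, sub_mul, neg_mul, Finset.sum_add_distrib,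
    Finset.sum_neg_distrib]
  simp only [ha] at t1 t2
  rw [t1, t2]
  ring

end GaussHessian

/-! ### Exchange of time and space derivatives, up to the ends of the time interval. -/

section MixedPartials

variable {m : ℕ} {W : Type*} [NormedAddCommGroup W] [NormedSpace ℝ W] {U : Set (Euc m)} {T : ℝ}
  {f : ℝ × Euc m → W}

theorem ContDiffOn.time_slice (hf : ContDiffOn ℝ ∞ f (Icc 0 T ×ˢ U)) {t : ℝ}
    (ht : t ∈ Icc 0 T) : ContDiffOn ℝ ∞ (fun y => f (t, y)) U :=
  hf.comp (contDiff_prodMk_right t).contDiffOn fun _ hy => ⟨ht, hy⟩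

theorem ContDiffOn.space_slice (hf : ContDiffOn ℝ ∞ f (Icc 0 T ×ˢ U)) {y : Euc m}
    (hy : y ∈ U) : ContDiffOn ℝ ∞ (fun t => f (t, y)) (Icc 0 T) :=
  hf.comp (contDiff_prodMk_left y).contDiffOn fun _ ht => ⟨ht, hy⟩

theorem uniqueDiffOn_slab (hT : 0 < T) (hU : IsOpen U) :
    UniqueDiffOn ℝ (Icc 0 T ×ˢ U) := (uniqueDiffOn_Icc hT).prod hU.uniqueDiffOn

theorem coordDeriv_time_slice (hU : IsOpen U)
    (hf : ContDiffOn ℝ ∞ f (Icc 0 T ×ˢ U)) {t : ℝ} (ht : t ∈ Icc 0 T) {y : Euc m} (hy : y ∈ U)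
    (i : Fin m) : coordDeriv i (fun z => f (t, z)) y =
      fderivWithin ℝ f (Icc 0 T ×ˢ U) (t, y) (0, EuclideanSpace.single i 1) := by
  have h1 : HasFDerivWithinAt f (fderivWithin ℝ f (Icc 0 T ×ˢ U) (t, y)) (Icc 0 T ×ˢ U) (t, y) :=
    ((hf.differentiableOn (by simp)) (t, y) ⟨ht, hy⟩).hasFDerivWithinAt
  have h2 := h1.comp (s := U) y (hasFDerivAt_prodMk_right (𝕜 := ℝ) t y).hasFDerivWithinAt
    (fun z hz => ⟨ht, hz⟩)
  have h3 := (h2.hasFDerivAt (hU.mem_nhds hy)).fderiv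
  rw [coordDeriv]
  exact congrArg (fun L => L (EuclideanSpace.single i 1)) h3

/-- The velocity `V` is the time component of the derivative of `f` within the slab. This gives its
smoothness with no formula for `V`, and reduces the exchange to symmetry of the second derivative
within the slab. -/
theorem coordDeriv_time_deriv (hT : 0 < T) (hU : IsOpen U)
    (hf : ContDiffOn ℝ ∞ f (Icc 0 T ×ˢ U)) {t : ℝ} (ht : t ∈ Icc 0 T) {V : Euc m → W}
    (hV : ∀ y ∈ U, HasDerivWithinAt (fun s => f (s, y)) (V y) (Icc 0 T) t) :
    ContDiffOn ℝ ∞ V U ∧ ∀ y ∈ U, ∀ i, HasDerivWithinAt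
      (fun s => coordDeriv i (fun z => f (s, z)) y) (coordDeriv i V y) (Icc 0 T) t := by
  set Q := Icc 0 T ×ˢ U with hQ
  have hQu : UniqueDiffOn ℝ Q := uniqueDiffOn_slab hT hU
  have hD : ContDiffOn ℝ ∞ (fderivWithin ℝ f Q) Q := hf.fderivWithin hQu le_rfl
  have hVD : ∀ y ∈ U, V y = fderivWithin ℝ f Q (t, y) (1, 0) := by
    intro y hy
    have h1 : HasFDerivWithinAt f (fderivWithin ℝ f Q (t, y)) Q (t, y) :=
      ((hf.differentiableOn (by simp)) (t, y) ⟨ht, hy⟩).hasFDerivWithinAt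
    have h2 := (h1.comp (s := Icc 0 T) t (hasFDerivAt_prodMk_left (𝕜 := ℝ) t y).hasFDerivWithinAt
      (fun z hz => (⟨hz, hy⟩ : (z, y) ∈ Q))).hasDerivWithinAt
    have h3 := (uniqueDiffOn_Icc hT t ht).eq_deriv _ (hV y hy) h2
    rw [h3]
    simp
  have hVs : ContDiffOn ℝ ∞ V U :=
    ((hD.time_slice ht).clm_apply contDiffOn_const).congr hVD
  refine ⟨hVs, fun y hy i => ?_⟩
  set D2 := fderivWithin ℝ (fderivWithin ℝ f Q) Q (t, y)
  have h1 : HasFDerivWithinAt (fderivWithin ℝ f Q) D2 Q (t, y) :=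
    ((hD.differentiableOn (by simp)) (t, y) ⟨ht, hy⟩).hasFDerivWithinAt
  have h2 := (h1.comp (s := Icc 0 T) t (hasFDerivAt_prodMk_left (𝕜 := ℝ) t y).hasFDerivWithinAt
      (fun z hz => (⟨hz, hy⟩ : (z, y) ∈ Q))).hasDerivWithinAt
  have h3 := h2.clm_apply (hasDerivWithinAt_const t (Icc 0 T) ((0, EuclideanSpace.single i 1) :
    ℝ × Euc m))
  have h4 := h1.comp (s := U) y (hasFDerivAt_prodMk_right (𝕜 := ℝ) t y).hasFDerivWithinAt
    (fun z hz => ⟨ht, hz⟩)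
  have h5 := (h4.clm_apply (hasFDerivWithinAt_const ((1, 0) : ℝ × Euc m) y U)).hasFDerivAt
    (hU.mem_nhds hy)
  have h6 : coordDeriv i V y = D2 (0, EuclideanSpace.single i 1) (1, 0) := by
    rw [coordDeriv_congr hU hVD i hy, coordDeriv]
    refine (DFunLike.congr_fun h5.fderiv (EuclideanSpace.single i 1)).trans ?_
    rw [add_apply, ContinuousLinearMap.comp_apply,
      zero_apply, map_zero, zero_add]
    rfl
  -- At `t = 0` and `t = T` the symmetry persists because the point lies in the closure of the
  -- interior of the slab.
  have hsymm : IsSymmSndFDerivWithinAt ℝ f Q (t, y) := by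
    refine (hf (t, y) ⟨ht, hy⟩).isSymmSndFDerivWithinAt (n := ∞)
      (by simpa using WithTop.coe_le_coe.2 (le_top (a := (2 : ℕ∞)))) hQu ?_ ⟨ht, hy⟩
    rw [hQ, interior_prod_eq, interior_Icc, hU.interior_eq, closure_prod_eq,
      closure_Ioo hT.ne]
    exact ⟨ht, subset_closure hy⟩
  have h7 : coordDeriv i V y = D2 (1, 0) (0, EuclideanSpace.single i 1) := by
    rw [h6]; exact hsymm _ _
  have h8 : HasDerivWithinAt (fun s => fderivWithin ℝ f Q (s, y) (0, EuclideanSpace.single i 1))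
      (coordDeriv i V y) (Icc 0 T) t := by
    rw [h7]
    rw [map_zero, add_zero] at h3
    exact h3
  exact h8.congr (fun s hs => coordDeriv_time_slice hU hf hs hy i)
    (coordDeriv_time_slice hU hf ht hy i)

end MixedPartials

/-! ### Parallelism of `J` and the evolution of the Gauss map in a chart. -/

section LocalFlow

variable {m : ℕ} {U : Set (Euc m)}

theorem coordDeriv_linear {W : Type*} [NormedAddCommGroup W] [InnerProductSpace ℝ W]
    [FiniteDimensional ℝ W] {h : Euc m → W} {y : Euc m} (hh : DifferentiableAt ℝ h y)
    (L : W →ₗ[ℝ] ℝ) (i : Fin m) :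
    DifferentiableAt ℝ (fun z => L (h z)) y ∧
      coordDeriv i (fun z => L (h z)) y = L (coordDeriv i h y) := by
  have h1 : HasFDerivAt (fun z => L (h z)) ((LinearMap.toContinuousLinearMap L).comp
    (fderiv ℝ h y)) y := (LinearMap.toContinuousLinearMap L).hasFDerivAt.comp y hh.hasFDerivAt
  refine ⟨h1.differentiableAt, ?_⟩
  rw [coordDeriv, h1.fderiv]
  rfl

theorem coordDeriv_grassmannian (b : OrthonormalBasis (Fin (m + 2)) ℝ (Euc (m + 2)))
    {r : Euc m → MVec m} (hU : IsOpen U) (hr : ContDiffOn ℝ ∞ r U)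
    (hmem : ∀ y ∈ U, r y ∈ grassmannian m) {y : Euc m} (hy : y ∈ U)
    (hξ : exteriorPower.ιMulti ℝ m (fun i => b (Fin.castAdd 2 i)) = r y) (c : Fin m) :
    coordDeriv c r y =
      ∑ i, ∑ α, (inner ℝ (coordDeriv c r y) (frameE b i α) : ℝ) • frameE b i α := by
  -- Restricting `r` to a coordinate line reduces the claim to the velocity of a curve in the
  -- Grassmannian.
  let γ : ℝ → Euc m := fun s => y + s • EuclideanSpace.single c 1
  have hγ : HasDerivAt γ (EuclideanSpace.single c 1) 0 := by
    simpa [γ] using ((hasDerivAt_id (0 : ℝ)).smul_const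
      (EuclideanSpace.single c (1 : ℝ))).const_add y
  have hγ0 : γ 0 = y := by simp [γ]
  have hs : IsOpen (γ ⁻¹' U) := hU.preimage (by fun_prop)
  have h0 : (0 : ℝ) ∈ γ ⁻¹' U := by rwa [mem_preimage, hγ0]
  have hd : HasFDerivAt r (fderiv ℝ r y) (γ 0) := by
    rw [hγ0]
    exact (ContDiffOn.differentiableAt_of_isOpen hU hr hy).hasFDerivAt
  exact (grassmannian_velocity b h0 (hs.uniqueDiffWithinAt h0)
    (hd.comp_hasDerivAt 0 hγ).hasDerivWithinAt (fun u hu => hmem _ hu) (by simp [hγ0]) hξ).2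

/-- `J` is parallel: the normal derivative commutes with the rotation of the normal planes. -/
theorem inner_coordDeriv_normalJ {ornt : Orientation ℝ (Euc (m + 2)) (Fin (m + 2))}
    {b : OrthonormalBasis (Fin (m + 2)) ℝ (Euc (m + 2))}
    {r : Euc m → MVec m} {V H : Euc m → Euc (m + 2)} (hU : IsOpen U) (hr : ContDiffOn ℝ ∞ r U)
    (hV : ContDiffOn ℝ ∞ V U) (hH : ContDiffOn ℝ ∞ H U)
    (hmem : ∀ y ∈ U, r y ∈ grassmannian m) {y : Euc m} (hy : y ∈ U) (hb : IsAdapted ornt (r y) b)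
    (hVH : ∀ z ∈ U, V z = normalJ ornt (r z) (H z))
    (hHn : ∀ j : Fin m, inner ℝ (H y) (b (Fin.castAdd 2 j)) = (0 : ℝ)) (c : Fin m) (α : Fin 2) :
    (inner ℝ (coordDeriv c V y) (b (Fin.natAdd m α)) : ℝ) =
      inner ℝ (b (Fin.natAdd m 0)) (coordDeriv c H y) *
          inner ℝ (b (Fin.natAdd m 1)) (b (Fin.natAdd m α)) -
        inner ℝ (b (Fin.natAdd m 1)) (coordDeriv c H y) *
          inner ℝ (b (Fin.natAdd m 0)) (b (Fin.natAdd m α)) := by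
  have hrd := ContDiffOn.differentiableAt_of_isOpen hU hr hy
  have hVd := ContDiffOn.differentiableAt_of_isOpen hU hV hy
  have hHd := ContDiffOn.differentiableAt_of_isOpen hU hH hy
  set ν := b (Fin.natAdd m α) with hν
  have expand (w : Euc (m + 2)) (X : MVec m) :
      frameDet b w ν X = ∑ p, (inner ℝ w (b p) : ℝ) * frameDet b (b p) ν X := by
    conv_lhs => rw [← b.sum_repr' w, ← frameDetL_apply]
    rw [map_sum, LinearMap.sum_apply]
    refine Finset.sum_congr rfl fun p _ => ?_
    rw [map_smul, LinearMap.smul_apply, smul_eq_mul, frameDetL_apply, real_inner_comm]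
  have h1 : ∀ z ∈ U, (inner ℝ (V z) ν : ℝ) =
      ∑ p, (inner ℝ (H z) (b p) : ℝ) * frameDet b (b p) ν (r z) := by
    intro z hz
    rw [hVH z hz, inner_normalJ b hb.1 (exists_isAdapted ornt (hmem z hz)), expand]
  have hHp (p) : DifferentiableAt ℝ (fun z => (inner ℝ (H z) (b p) : ℝ)) y :=
    hHd.inner ℝ (differentiableAt_const _)
  have hfd (p) := coordDeriv_linear hrd (frameDet b (b p) ν) c
  have h2 := coordDeriv_congr hU h1 c hy
  rw [coordDeriv_inner_const hVd, coordDeriv_sum fun p => (hHp p).fun_mul (hfd p).1] at h2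
  rw [h2]
  have h3 (p) : coordDeriv c (fun z => (inner ℝ (H z) (b p) : ℝ) * frameDet b (b p) ν (r z)) y =
      inner ℝ (coordDeriv c H y) (b p) * frameDet b (b p) ν (r y) +
        inner ℝ (H y) (b p) * frameDet b (b p) ν (coordDeriv c r y) := by
    rw [coordDeriv_mul (hHp p) (hfd p).1, coordDeriv_inner_const hHd, (hfd p).2]
  simp only [h3]
  rw [Finset.sum_add_distrib, ← expand, Fin.sum_univ_add]
  -- The derivative of the plane contributes a determinant with three normal arguments, and the
  -- normal plane has dimension two. This is why `J` is parallel.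
  have h4 (β : Fin 2) : frameDet b (b (Fin.natAdd m β)) ν (coordDeriv c r y) = 0 := by
    rw [coordDeriv_grassmannian b hU hr hmem hy hb.2 c, map_sum]
    refine Finset.sum_eq_zero fun i _ => ?_
    rw [map_sum]
    refine Finset.sum_eq_zero fun γ _ => ?_
    rw [map_smul, hν, frameDet_frameE, smul_zero]
  simp only [hHn, h4, zero_mul, mul_zero, Finset.sum_const_zero, add_zero]
  rw [← hb.2, frameDet_frame]

theorem neg_smul_add_smul {M : Type*} [AddCommGroup M] [Module ℝ M] (a c : ℝ) (x y : M) :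
    (-a) • x + c • y = c • y - a • x := by
  module

/-- The evolution of the Gauss map under the skew mean curvature flow, in local coordinates. -/
theorem hasDerivWithinAt_gauss_of_flow {T : ℝ} (hT : 0 < T) (hU : IsOpen U)
    {f : ℝ × Euc m → Euc (m + 2)} {r : ℝ × Euc m → MVec m}
    {ornt : Orientation ℝ (Euc (m + 2)) (Fin (m + 2))}
    (hf : ContDiffOn ℝ ∞ f (Icc 0 T ×ˢ U)) (hr : ContDiffOn ℝ ∞ r (Icc 0 T ×ˢ U))
    (hmem : ∀ t ∈ Icc 0 T, ∀ y ∈ U, r (t, y) ∈ grassmannian m)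
    (hdet : ∀ t ∈ Icc 0 T, ∀ y ∈ U, (gramMat (fun z => f (t, z)) y).det ≠ 0)
    (hP : ∀ t ∈ Icc 0 T, ∀ y ∈ U, ∀ (i : Fin m) (e : Fin m → Euc (m + 2)) (ν : Euc (m + 2)),
      inner ℝ (coordDeriv i (fun z => f (t, z)) y) ν *
          inner ℝ (r (t, y)) (exteriorPower.ιMulti ℝ m e) =
        ∑ j, inner ℝ (coordDeriv i (fun z => f (t, z)) y) (e j) *
          (inner ℝ (r (t, y)) (exteriorPower.ιMulti ℝ m (Function.update e j ν)) : ℝ))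
    {t : ℝ} (ht : t ∈ Icc 0 T)
    (hflow : ∀ y ∈ U, HasDerivWithinAt (fun s => f (s, y))
      (normalJ ornt (r (t, y)) (meanCurv (fun z => f (t, z)) y)) (Icc 0 T) t)
    {y : Euc m} (hy : y ∈ U) {τ : MVec m}
    (hτ : ∀ b, IsAdapted ornt (r (t, y)) b → ∀ j α, (inner ℝ (frameE b j α) τ : ℝ) =
      ∑ k, ∑ l, (gramMat (fun z => f (t, z)) y)⁻¹ k l *
        (inner ℝ (coordDeriv k (coordDeriv l fun z => r (t, z)) y) (frameE b j α) -
          ∑ d, tangentCoeff (fun z => f (t, z)) y d k l *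
            inner ℝ (coordDeriv d (fun z => r (t, z)) y) (frameE b j α))) :
    HasDerivWithinAt (fun s => r (s, y)) (grassmannJ ornt (r (t, y)) τ) (Icc 0 T) t := by
  have hex := exists_isAdapted ornt (hmem t ht y hy)
  rw [grassmannJ, dif_pos hex]
  have hb := hex.choose_spec
  revert hb
  generalize hex.choose = b
  intro hb
  have hrs : DifferentiableWithinAt ℝ (fun s => r (s, y)) (Icc 0 T) t :=
    ((hr.space_slice hy).differentiableOn (by simp)) t ht
  obtain ⟨r', hr'⟩ : ∃ r', HasDerivWithinAt (fun s => r (s, y)) r' (Icc 0 T) t :=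
    ⟨_, hrs.hasDerivWithinAt⟩
  have hut := uniqueDiffOn_Icc hT t ht
  suffices h : r' = ∑ i, ((inner ℝ (frameE b i 0) τ : ℝ) • frameE b i 1 -
      (inner ℝ (frameE b i 1) τ : ℝ) • frameE b i 0) by
    rw [← h]; exact hr'
  have hvel := (grassmannian_velocity b ht hut hr' (fun s hs => hmem s hs y hy) rfl hb.2).2
  set h := fun z => f (t, z) with hh
  have hhs : ContDiffOn ℝ ∞ h U := hf.time_slice ht
  have hrt : ContDiffOn ℝ ∞ (fun z => r (t, z)) U := hr.time_slice ht
  have hrr : inner ℝ (r (t, y)) (r (t, y)) = (1 : ℝ) := by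
    rw [real_inner_self_eq_norm_sq, norm_of_mem_grassmannian (hmem t ht y hy)]; norm_num
  have hPb (s) (hs : s ∈ Icc 0 T) (z) (hz : z ∈ U) (i : Fin m) (α : Fin 2) :
      inner ℝ (coordDeriv i (fun z => f (s, z)) z) (b (Fin.natAdd m α)) *
          inner ℝ (r (s, z)) (r (t, y)) =
        ∑ j : Fin m, inner ℝ (coordDeriv i (fun z => f (s, z)) z) (b (Fin.castAdd 2 j)) *
          (inner ℝ (r (s, z)) (frameE b j α) : ℝ) := by
    rw [← hb.2]
    exact hP s hs z hz i _ _
  have hrE (j : Fin m) (α : Fin 2) : inner ℝ (r (t, y)) (frameE b j α) = (0 : ℝ) := by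
    rw [← hb.2, inner_wedge_frameE]
  have hn (i : Fin m) (α : Fin 2) :
      inner ℝ (coordDeriv i h y) (b (Fin.natAdd m α)) = (0 : ℝ) := by
    have := hPb t ht y hy i α
    rw [hrr, mul_one] at this
    simpa [hrE] using this
  have hMdet := frameMat_det_ne_zero b (hdet t ht y hy) hn
  have hHn (j : Fin m) : inner ℝ (meanCurv h y) (b (Fin.castAdd 2 j)) = (0 : ℝ) := by
    have h1 : (frameMat b h y).mulVec
        (fun j => inner ℝ (meanCurv h y) (b (Fin.castAdd 2 j))) = 0 := by
      funext l
      have := inner_meanCurv (hdet t ht y hy) l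
      rw [inner_eq_sum_of_normal b (hn l)] at this
      simp only [Matrix.mulVec, dotProduct, frameMat, Matrix.of_apply, Pi.zero_apply]
      rw [← this]
      exact Finset.sum_congr rfl fun j _ => mul_comm _ _
    exact congrFun (Matrix.eq_zero_of_mulVec_eq_zero hMdet h1) j
  have hHs : ContDiffOn ℝ ∞ (meanCurv h) U := contDiffOn_meanCurv hU hhs (hdet t ht)
  obtain ⟨hVs, hVt⟩ := coordDeriv_time_deriv hT hU hf ht hflow
  have hJ := inner_coordDeriv_normalJ hU hrt hVs hHs (hmem t ht) hy hb (fun _ _ => rfl) hHn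
  -- Time derivative of `hPb` at `(t, y)`: the factors `⟨∂_c h, ν_α⟩` and `⟨r, E_jα⟩` vanish there,
  -- so only the normal part of `∂_c V` and the components of `r'` remain.
  have htime (c : Fin m) (α : Fin 2) :
      ∑ j, inner ℝ (coordDeriv c h y) (b (Fin.castAdd 2 j)) * inner ℝ r' (frameE b j α) =
        (inner ℝ (coordDeriv c (fun y => normalJ ornt (r (t, y)) (meanCurv h y)) y)
          (b (Fin.natAdd m α)) : ℝ) := by
    have e1 := ((hVt y hy c).inner ℝ (hasDerivWithinAt_const t (Icc 0 T)
      (b (Fin.natAdd m α)))).mul (hr'.inner ℝ (hasDerivWithinAt_const t (Icc 0 T) (r (t, y))))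
    have e2 := HasDerivWithinAt.fun_sum (u := Finset.univ) fun (j : Fin m) _ =>
      ((hVt y hy c).inner ℝ (hasDerivWithinAt_const t (Icc 0 T)
      (b (Fin.castAdd 2 j)))).mul
        (hr'.inner ℝ (hasDerivWithinAt_const t (Icc 0 T) (frameE b j α)))
    have e3 := e2.congr (fun s hs => hPb s hs y hy c α) (hPb t ht y hy c α)
    have e4 := hut.eq_deriv _ e1 e3
    simp only [inner_zero_right, zero_add, hrr, hrE, mul_one, mul_zero] at e4
    have hn' : inner ℝ (coordDeriv c (fun z => f (t, z)) y) (b (Fin.natAdd m α)) = (0 : ℝ) :=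
      hn c α
    rw [hn', zero_mul, add_zero] at e4
    exact e4.symm
  have hspace (c : Fin m) (α : Fin 2) :
      ∑ j, inner ℝ (coordDeriv c h y) (b (Fin.castAdd 2 j)) * inner ℝ (frameE b j α) τ =
        (inner ℝ (coordDeriv c (meanCurv h) y) (b (Fin.natAdd m α)) : ℝ) := by
    simp only [hτ b hb]
    exact sum_frame_tension b hU hhs (hdet t ht) hrt (hmem t ht) hy hb.2 (hPb t ht) α c
  -- The matrix `⟨∂_c h, eⱼ⟩` is invertible, so components may be compared after contraction with
  -- it.
  have hinj {x x' : Fin m → ℝ} (hx : ∀ c, ∑ j, inner ℝ (coordDeriv c h y) (b (Fin.castAdd 2 j)) *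
      x j = ∑ j, inner ℝ (coordDeriv c h y) (b (Fin.castAdd 2 j)) * x' j) : x = x' := by
    rw [← sub_eq_zero]
    refine Matrix.eq_zero_of_mulVec_eq_zero hMdet ?_
    rw [Matrix.mulVec_sub, sub_eq_zero]
    exact funext hx
  have h1 : (fun j => (inner ℝ r' (frameE b j 1) : ℝ)) = fun j => inner ℝ (frameE b j 0) τ := by
    refine hinj fun c => ?_
    rw [htime, hspace, hJ]
    simp [real_inner_comm]
  have h0 : (fun j => (inner ℝ r' (frameE b j 0) : ℝ)) =
      fun j => -inner ℝ (frameE b j 1) τ := by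
    refine hinj fun c => ?_
    simp only [mul_neg, Finset.sum_neg_distrib]
    rw [htime, hspace, hJ]
    simp [real_inner_comm]
  refine hvel.trans (Finset.sum_congr rfl fun i _ => ?_)
  rw [Fin.sum_univ_two, congrFun h1 i, congrFun h0 i]
  exact neg_smul_add_smul _ _ _ _

end LocalFlow

/-! ### Independence of the mean curvature vector from the parametrization. -/

section Reparametrization

variable {m n : ℕ} {U : Set (Euc m)} {h : Euc m → Euc n}

theorem gramMat_det_ne_zero_iff {y : Euc m} :
    (gramMat h y).det ≠ 0 ↔ LinearIndependent ℝ fun i => coordDeriv i h y :=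
  Matrix.det_gram_ne_zero_iff_linearIndependent

theorem starProjection_coordDeriv2 {y : Euc m} (hdet : (gramMat h y).det ≠ 0) (i j : Fin m) :
    (Submodule.span ℝ (range fun i => coordDeriv i h y))ᗮ.starProjection
      (coordDeriv i (coordDeriv j h) y) =
      coordDeriv i (coordDeriv j h) y - ∑ k, tangentCoeff h y k i j • coordDeriv k h y := by
  refine Submodule.eq_starProjection_of_mem_orthogonal ?_ ?_
  · rw [Submodule.mem_orthogonal]
    intro u hu
    induction hu using Submodule.span_induction with
    | mem x hx =>
      obtain ⟨l, rfl⟩ := hx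
      rw [real_inner_comm]
      exact inner_normal_part hdet i j l
    | zero => simp
    | add x y _ _ hx hy => rw [inner_add_left, hx, hy, add_zero]
    | smul c x _ hx => rw [real_inner_smul_left, hx, mul_zero]
  · rw [sub_sub_cancel, Submodule.orthogonal_orthogonal]
    exact Submodule.sum_mem _ fun k _ => Submodule.smul_mem _ _ (Submodule.subset_span ⟨k, rfl⟩)

theorem meanCurv_eq_sum_starProjection {y : Euc m} (hdet : (gramMat h y).det ≠ 0) :
    meanCurv h y = ∑ i, ∑ j, (gramMat h y)⁻¹ i j •
      (Submodule.span ℝ (range fun i => coordDeriv i h y))ᗮ.starProjection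
        (coordDeriv i (coordDeriv j h) y) := by
  simp only [starProjection_coordDeriv2 hdet]
  rfl

theorem coordDeriv_comp {W : Type*} [NormedAddCommGroup W] [NormedSpace ℝ W] {h : Euc m → W}
    {ψ : Euc m → Euc m} {z : Euc m} (hh : DifferentiableAt ℝ h (ψ z))
    (hψ : DifferentiableAt ℝ ψ z) (j : Fin m) :
    coordDeriv j (fun z => h (ψ z)) z = ∑ a, coordDeriv j ψ z a • coordDeriv a h (ψ z) := by
  have h1 : fderiv ℝ (fun z => h (ψ z)) z = (fderiv ℝ h (ψ z)).comp (fderiv ℝ ψ z) :=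
    fderiv_comp z hh hψ
  unfold coordDeriv
  rw [h1, ContinuousLinearMap.comp_apply]
  set v := fderiv ℝ ψ z (EuclideanSpace.single j 1)
  conv_lhs => rw [← (EuclideanSpace.basisFun (Fin m) ℝ).sum_repr v]
  simp [map_sum]

/-- The mean curvature vector does not depend on the parametrization. -/
theorem meanCurv_comp {U' : Set (Euc m)} {ψ : Euc m → Euc m} (hU : IsOpen U) (hU' : IsOpen U')
    (hh : ContDiffOn ℝ ∞ h U) (hψ : ContDiffOn ℝ ∞ ψ U') (hmaps : MapsTo ψ U' U)
    {z : Euc m} (hz : z ∈ U') (hdet : (gramMat h (ψ z)).det ≠ 0)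
    (hdet' : (gramMat (fun z => h (ψ z)) z).det ≠ 0) :
    meanCurv (fun z => h (ψ z)) z = meanCurv h (ψ z) := by
  set k := fun z => h (ψ z) with hk
  have hψd (w) (hw : w ∈ U') := ContDiffOn.differentiableAt_of_isOpen hU' hψ hw
  have hhd (w) (hw : w ∈ U) := ContDiffOn.differentiableAt_of_isOpen hU hh hw
  let L : Matrix (Fin m) (Fin m) ℝ := Matrix.of fun j a => coordDeriv j ψ z a
  have first : ∀ w ∈ U', ∀ j, coordDeriv j k w = ∑ a, coordDeriv j ψ w a • coordDeriv a h (ψ w) :=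
    fun w hw j => coordDeriv_comp (hhd _ (hmaps hw)) (hψd w hw) j
  have hG : gramMat k z = L * gramMat h (ψ z) * L.transpose := by
    ext i j
    simp only [gramMat, Matrix.of_apply, Matrix.mul_apply, Matrix.transpose_apply, L,
      first z hz, sum_inner, inner_sum, real_inner_smul_left, real_inner_smul_right,
      Finset.sum_mul]
    refine Finset.sum_congr rfl fun a _ => Finset.sum_congr rfl fun b _ => ?_
    ring
  have hL : IsUnit L.det := by
    rw [hG, Matrix.det_mul, Matrix.det_mul] at hdet'
    exact isUnit_iff_ne_zero.2 (left_ne_zero_of_mul (left_ne_zero_of_mul hdet'))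
  have hspan : Submodule.span ℝ (range fun i => coordDeriv i k z) =
      Submodule.span ℝ (range fun i => coordDeriv i h (ψ z)) := by
    have hle : Submodule.span ℝ (range fun i => coordDeriv i k z) ≤
        Submodule.span ℝ (range fun i => coordDeriv i h (ψ z)) := by
      rw [Submodule.span_le]
      rintro _ ⟨i, rfl⟩
      simp only [first z hz]
      exact Submodule.sum_mem _ fun a _ =>
        Submodule.smul_mem _ _ (Submodule.subset_span ⟨a, rfl⟩)
    refine Submodule.eq_of_le_of_finrank_eq hle ?_
    rw [finrank_span_eq_card (gramMat_det_ne_zero_iff.1 hdet),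
      finrank_span_eq_card (gramMat_det_ne_zero_iff.1 hdet')]
  rw [meanCurv_eq_sum_starProjection hdet', meanCurv_eq_sum_starProjection hdet, hspan]
  set P := (Submodule.span ℝ (range fun i => coordDeriv i h (ψ z)))ᗮ.starProjection with hPdef
  -- The normal projection kills the terms of the chain rule with second derivatives of `ψ`, so the
  -- projected Hessian transforms as a tensor.
  have hP0 (a : Fin m) : P (coordDeriv a h (ψ z)) = 0 :=
    Submodule.starProjection_orthogonal_apply_eq_zero (Submodule.subset_span ⟨a, rfl⟩)
  have hc (j a : Fin m) : DifferentiableAt ℝ (fun w => coordDeriv j ψ w a) z := by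
    have := ContDiffOn.differentiableAt_of_isOpen hU' (hψ.coordDeriv hU' j) hz
    fun_prop
  have hha (a : Fin m) : DifferentiableAt ℝ (coordDeriv a h) (ψ z) :=
    ContDiffOn.differentiableAt_of_isOpen hU (hh.coordDeriv hU a) (hmaps hz)
  have hhψ (a : Fin m) : DifferentiableAt ℝ (fun w => coordDeriv a h (ψ w)) z :=
    (hha a).comp z (hψd z hz)
  have second (i j : Fin m) : P (coordDeriv i (coordDeriv j k) z) =
      ∑ a, ∑ b, (L i a * L j b) • P (coordDeriv a (coordDeriv b h) (ψ z)) := by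
    rw [coordDeriv_congr hU' (fun w hw => first w hw j) i hz,
      coordDeriv_sum fun a => (hc j a).fun_smul (hhψ a), map_sum, Finset.sum_comm]
    refine Finset.sum_congr rfl fun b _ => ?_
    rw [coordDeriv_smul (hc j b) (hhψ b), map_add, map_smul, hP0, smul_zero, zero_add,
      coordDeriv_comp (hha b) (hψd z hz), map_smul, map_sum, Finset.smul_sum]
    refine Finset.sum_congr rfl fun a _ => ?_
    rw [map_smul, smul_smul, mul_comm]
    rfl
  simp only [second]
  have hinv : L.transpose * (gramMat k z)⁻¹ * L = (gramMat h (ψ z))⁻¹ := by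
    rw [hG, Matrix.mul_inv_rev, Matrix.mul_inv_rev]
    have hLt : IsUnit L.transpose.det := by rwa [Matrix.det_transpose]
    rw [← Matrix.mul_assoc, Matrix.mul_nonsing_inv _ hLt, Matrix.one_mul, Matrix.mul_assoc,
      Matrix.nonsing_inv_mul _ hL, Matrix.mul_one]
  rw [← hinv]
  simp only [Matrix.mul_apply, Matrix.transpose_apply, Finset.sum_mul, Finset.sum_smul,
    Finset.smul_sum, smul_smul]
  have reorder (Φ : Fin m → Fin m → Fin m → Fin m → Euc n) :
      ∑ i, ∑ j, ∑ a, ∑ b, Φ i j a b = ∑ a, ∑ b, ∑ j, ∑ i, Φ i j a b := by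
    rw [Finset.sum_comm]
    rw [Finset.sum_congr rfl fun j _ => Finset.sum_comm]
    rw [Finset.sum_comm]
    refine Finset.sum_congr rfl fun a _ => ?_
    rw [Finset.sum_congr rfl fun j _ => Finset.sum_comm]
    rw [Finset.sum_comm]
  rw [reorder]
  refine Finset.sum_congr rfl fun a _ => Finset.sum_congr rfl fun b _ =>
    Finset.sum_congr rfl fun j _ => Finset.sum_congr rfl fun i _ => ?_
  congr 1
  ring

end Reparametrization

/-! ### Passage from the manifold to charts. -/

section Charts

variable {m n : ℕ} {S : Type*} [TopologicalSpace S] [ChartedSpace (Euc m) S]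

theorem isOpen_chart_target (x : S) : IsOpen (extChartAt (𝓡 m) x).target :=
  isOpen_extChartAt_target x

theorem chartPt_mem (x : S) : chartPt x ∈ (extChartAt (𝓡 m) x).target :=
  mem_extChartAt_target x

theorem chart_symm_chartPt (x : S) : (extChartAt (𝓡 m) x).symm (chartPt x) = x :=
  extChartAt_to_inv x

variable [IsManifold (𝓡 m) ∞ S]

theorem contDiffOn_inChart {W : Type*} [NormedAddCommGroup W] [NormedSpace ℝ W] {f : S → W}
    (hf : ContMDiff (𝓡 m) 𝓘(ℝ, W) ∞ f) (x : S) :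
    ContDiffOn ℝ ∞ (inChart x f) (extChartAt (𝓡 m) x).target := by
  rw [← contMDiffOn_iff_contDiffOn]
  exact hf.comp_contMDiffOn (contMDiffOn_extChartAt_symm x)

theorem mdifferentiableAt_chart_symm (x : S) {y : Euc m}
    (hy : y ∈ (extChartAt (𝓡 m) x).target) :
    MDifferentiableAt 𝓘(ℝ, Euc m) (𝓡 m) (extChartAt (𝓡 m) x).symm y :=
  ((contMDiffOn_extChartAt_symm (n := ∞) x).contMDiffAt
    ((isOpen_chart_target x).mem_nhds hy)).mdifferentiableAt (by simp)

theorem differential_coordVec {W : Type*} [NormedAddCommGroup W] [NormedSpace ℝ W] {f : S → W}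
    (hf : ContMDiff (𝓡 m) 𝓘(ℝ, W) ∞ f) (x : S) {y : Euc m}
    (hy : y ∈ (extChartAt (𝓡 m) x).target) (i : Fin m) :
    differential f ((extChartAt (𝓡 m) x).symm y) (coordVec x i y) =
      coordDeriv i (inChart x f) y := by
  have h1 : mfderiv 𝓘(ℝ, Euc m) 𝓘(ℝ, W) (f ∘ (extChartAt (𝓡 m) x).symm) y =
      (mfderiv (𝓡 m) 𝓘(ℝ, W) f ((extChartAt (𝓡 m) x).symm y)).comp
        (mfderiv 𝓘(ℝ, Euc m) (𝓡 m) (extChartAt (𝓡 m) x).symm y) :=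
    mfderiv_comp y (hf.mdifferentiableAt (by simp)) (mdifferentiableAt_chart_symm x hy)
  rw [mfderiv_eq_fderiv] at h1
  exact (congrArg (fun L : Euc m →L[ℝ] W => L (EuclideanSpace.single i 1)) h1).symm

theorem coordVec_isInvertible (x : S) {y : Euc m} (hy : y ∈ (extChartAt (𝓡 m) x).target) :
    (mfderiv 𝓘(ℝ, Euc m) (𝓡 m) (extChartAt (𝓡 m) x).symm y).IsInvertible := by
  have := isInvertible_mfderivWithin_extChartAt_symm (I := 𝓡 m) hy
  rwa [ModelWithCorners.range_eq_univ, mfderivWithin_univ] at this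

/-- The coordinate vector fields of a chart at a point, as a basis of the tangent space. -/
noncomputable def coordBasis (x : S) {y : Euc m} (hy : y ∈ (extChartAt (𝓡 m) x).target) :
    Module.Basis (Fin m) ℝ (TangentSpace (𝓡 m) ((extChartAt (𝓡 m) x).symm y)) :=
  (EuclideanSpace.basisFun (Fin m) ℝ).toBasis.map
    (coordVec_isInvertible x hy).choose.toLinearEquiv

theorem coordBasis_apply (x : S) {y : Euc m} (hy : y ∈ (extChartAt (𝓡 m) x).target) (i : Fin m) :
    coordBasis x hy i = coordVec x i y := by
  have h := (coordVec_isInvertible x hy).choose_spec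
  have h1 : coordBasis x hy i = (coordVec_isInvertible x hy).choose
      ((EuclideanSpace.basisFun (Fin m) ℝ).toBasis i) := rfl
  rw [h1, OrthonormalBasis.coe_toBasis, EuclideanSpace.basisFun_apply, coordVec]
  exact congrArg (fun L : Euc m →L[ℝ] TangentSpace (𝓡 m) ((extChartAt (𝓡 m) x).symm y) =>
    L (EuclideanSpace.single i 1)) h

theorem tangentPlane_eq_span {f : S → Euc n} (hf : ContMDiff (𝓡 m) 𝓘(ℝ, Euc n) ∞ f) (x : S)
    {y : Euc m} (hy : y ∈ (extChartAt (𝓡 m) x).target) :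
    tangentPlane (m := m) f ((extChartAt (𝓡 m) x).symm y) =
      Submodule.span ℝ (range fun i => coordDeriv i (inChart x f) y) := by
  rw [tangentPlane, LinearMap.range_eq_map, ← (coordBasis x hy).span_eq, Submodule.map_span,
    ← range_comp]
  congr 2
  funext i
  simp only [Function.comp_apply, coordBasis_apply]
  exact differential_coordVec hf x hy i

theorem gramMat_inChart_det_ne_zero {f : S → Euc n} (hf : ContMDiff (𝓡 m) 𝓘(ℝ, Euc n) ∞ f)
    (himm : ∀ x, Function.Injective (differential (m := m) f x)) (x : S) {y : Euc m}
    (hy : y ∈ (extChartAt (𝓡 m) x).target) : (gramMat (inChart x f) y).det ≠ 0 := by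
  rw [gramMat_det_ne_zero_iff]
  have h1 := (coordBasis x hy).linearIndependent.map'
    (differential f ((extChartAt (𝓡 m) x).symm y)).toLinearMap
    (LinearMap.ker_eq_bot.2 (himm _))
  have h2 : (fun i => coordDeriv i (inChart x f) y) =
      (differential f ((extChartAt (𝓡 m) x).symm y)).toLinearMap ∘ coordBasis x hy := by
    funext i
    rw [Function.comp_apply, coordBasis_apply]
    exact (differential_coordVec hf x hy i).symm
  rw [h2]
  exact h1

theorem metricMatrix_inducedMetric {f : S → Euc n} (hf : ContMDiff (𝓡 m) 𝓘(ℝ, Euc n) ∞ f)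
    (x : S) {y : Euc m} (hy : y ∈ (extChartAt (𝓡 m) x).target) :
    metricMatrix (m := m) (inducedMetric f) x y = gramMat (inChart x f) y := by
  ext i j
  simp only [metricMatrix, gramMat, Matrix.of_apply, inducedMetric,
    differential_coordVec hf x hy]

/-- With `g_ij = ⟨∂ᵢf, ∂ⱼf⟩`, everything in `∂ᵢg_jl + ∂ⱼg_il - ∂_l g_ij` cancels except `2⟨∂ᵢ∂ⱼf,
∂_l f⟩`. -/
theorem christoffel_inducedMetric {f : S → Euc n} (hf : ContMDiff (𝓡 m) 𝓘(ℝ, Euc n) ∞ f)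
    (x : S) (k i j : Fin m) :
    christoffel (m := m) (inducedMetric f) x k i j =
      tangentCoeff (inChart x f) (chartPt x) k i j := by
  have hU := isOpen_chart_target (m := m) x
  have hs := contDiffOn_inChart hf x
  have hy := chartPt_mem (m := m) x
  have hd (c i j : Fin m) :
      coordDeriv c (fun y => metricMatrix (m := m) (inducedMetric f) x y i j) (chartPt x) =
      inner ℝ (coordDeriv c (coordDeriv i (inChart x f)) (chartPt x))
        (coordDeriv j (inChart x f) (chartPt x)) +
      inner ℝ (coordDeriv i (inChart x f) (chartPt x))
        (coordDeriv c (coordDeriv j (inChart x f)) (chartPt x)) := by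
    rw [coordDeriv_congr hU (fun y hy => congrFun (congrFun (metricMatrix_inducedMetric hf x hy) i)
      j) c hy]
    exact coordDeriv_gramMat hU hs hy c i j
  rw [christoffel, tangentCoeff, metricMatrix_inducedMetric hf x hy, Finset.mul_sum]
  refine Finset.sum_congr rfl fun l _ => ?_
  rw [hd, hd, hd, coordDeriv_comm hU hs hy j i, coordDeriv_comm hU hs hy l i,
    coordDeriv_comm hU hs hy l j, real_inner_comm (coordDeriv j (inChart x f) (chartPt x))]
  ring

theorem meanCurvature_eq_meanCurv {f : S → Euc n} (hf : ContMDiff (𝓡 m) 𝓘(ℝ, Euc n) ∞ f)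
    (himm : ∀ x, Function.Injective (differential (m := m) f x)) (x : S) :
    meanCurvature (m := m) f x = meanCurv (inChart x f) (chartPt (m := m) x) := by
  have hy := chartPt_mem (m := m) x
  have hT := tangentPlane_eq_span hf x hy
  rw [chart_symm_chartPt] at hT
  rw [meanCurv_eq_sum_starProjection (gramMat_inChart_det_ne_zero hf himm x hy), meanCurvature,
    metricMatrix_inducedMetric hf x hy]
  simp only [secondFundamentalForm, hT]

/-- The mean curvature vector can be computed in any chart. -/
theorem meanCurvature_chart_symm {f : S → Euc n} (hf : ContMDiff (𝓡 m) 𝓘(ℝ, Euc n) ∞ f)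
    (himm : ∀ x, Function.Injective (differential (m := m) f x)) (x : S) {y : Euc m}
    (hy : y ∈ (extChartAt (𝓡 m) x).target) :
    meanCurvature (m := m) f ((extChartAt (𝓡 m) x).symm y) = meanCurv (inChart x f) y := by
  set x' := (extChartAt (𝓡 m) x).symm y with hx'
  rw [meanCurvature_eq_meanCurv hf himm x']
  have hx's : x' ∈ (extChartAt (𝓡 m) x).source := (extChartAt (𝓡 m) x).map_target hy
  -- The transition from the preferred chart at `x'`, in which the mean curvature there is defined,
  -- to the fixed chart at `x`.
  set ψ : Euc m → Euc m := fun z => extChartAt (𝓡 m) x ((extChartAt (𝓡 m) x').symm z) with hψ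
  set U' : Set (Euc m) := (extChartAt (𝓡 m) x').target ∩
    (extChartAt (𝓡 m) x').symm ⁻¹' (extChartAt (𝓡 m) x).source with hU'
  have hU'o : IsOpen U' := (continuousOn_extChartAt_symm x').isOpen_inter_preimage
    (isOpen_chart_target x') (isOpen_extChartAt_source x)
  have hz : chartPt x' ∈ U' := ⟨chartPt_mem x', by rwa [mem_preimage, chart_symm_chartPt]⟩
  have hψs : ContDiffOn ℝ ∞ ψ U' := by
    rw [← contMDiffOn_iff_contDiffOn]
    refine (contMDiffOn_extChartAt (n := ∞) (x := x)).comp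
      ((contMDiffOn_extChartAt_symm x').mono inter_subset_left) fun z hz => ?_
    have := hz.2
    rwa [mem_preimage, extChartAt_source] at this
  have hmaps : MapsTo ψ U' (extChartAt (𝓡 m) x).target := fun z hz =>
    (extChartAt (𝓡 m) x).map_source hz.2
  have hψz : ψ (chartPt x') = y := by
    rw [hψ]
    simp only [chart_symm_chartPt]
    exact (extChartAt (𝓡 m) x).right_inv hy
  have heq : ∀ z ∈ U', inChart x' f z = inChart x f (ψ z) := fun z hz => by
    simp only [inChart, hψ]
    rw [(extChartAt (𝓡 m) x).left_inv hz.2]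
  have heq1 (i : Fin m) : ∀ z ∈ U', coordDeriv i (inChart x' f) z =
      coordDeriv i (fun z => inChart x f (ψ z)) z := fun z hz =>
    coordDeriv_congr hU'o heq i hz
  have hg : gramMat (inChart x' f) (chartPt (m := m) x') =
      gramMat (fun z => inChart x f (ψ z)) (chartPt x') := by
    ext i j
    simp only [gramMat, heq1 _ _ hz]
  have hm : meanCurv (inChart x' f) (chartPt (m := m) x') =
      meanCurv (fun z => inChart x f (ψ z)) (chartPt x') := by
    have h2 (i j : Fin m) : coordDeriv i (coordDeriv j (inChart x' f)) (chartPt x') =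
        coordDeriv i (coordDeriv j fun z => inChart x f (ψ z)) (chartPt x') :=
      coordDeriv_congr hU'o (heq1 j) i hz
    simp only [meanCurv, tangentCoeff, hg, heq1 _ _ hz, h2]
  have hd' := gramMat_inChart_det_ne_zero hf himm x' (chartPt_mem (m := m) x')
  rw [hg] at hd'
  rw [hm, meanCurv_comp (isOpen_chart_target x) hU'o (contDiffOn_inChart hf x) hψs hmaps hz
    (by rw [hψz]; exact gramMat_inChart_det_ne_zero hf himm x hy) hd', hψz]

end Charts

/-! ### The Gauss map in terms of arbitrary bases, and orientations. -/

section GaussMap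

variable {m : ℕ} {S : Type*} [TopologicalSpace S] [ChartedSpace (Euc m) S]
  [IsManifold (𝓡 m) ∞ S]

/-- An orthonormal basis of the image plane, adjusted to the transported orientation, is pulled
back. The adjustment negates a basis vector, so it requires `m > 0`. -/
theorem exists_oriented_orthonormal (hm : 0 < m) (o : ManifoldOrientation m S)
    {f : S → Euc (m + 2)} {x : S} (himm : Function.Injective (differential (m := m) f x)) :
    ∃ ε : Module.Basis (Fin m) ℝ (TangentSpace (𝓡 m) x),
      ε.orientation = o.at_point x ∧ Orthonormal ℝ (fun i => differential f x (ε i)) := by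
  have : Nonempty (Fin m) := ⟨⟨0, hm⟩⟩
  let D : TangentSpace (𝓡 m) x →ₗ[ℝ] Euc (m + 2) := (differential f x).toLinearMap
  let e : TangentSpace (𝓡 m) x ≃ₗ[ℝ] LinearMap.range D := LinearEquiv.ofInjective D himm
  have hfin : Module.finrank ℝ (LinearMap.range D) = m := by
    rw [← e.finrank_eq]
    exact finrank_euclideanSpace_fin
  let bb : OrthonormalBasis (Fin m) ℝ (LinearMap.range D) :=
    ((stdOrthonormalBasis ℝ (LinearMap.range D)).reindex (finCongr hfin)).adjustToOrientation
      (Orientation.map (Fin m) e (o.at_point x))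
  refine ⟨bb.toBasis.map e.symm, ?_, ?_⟩
  · rw [Module.Basis.orientation_map, OrthonormalBasis.orientation_adjustToOrientation,
      ← Orientation.map_symm, Equiv.symm_apply_apply]
  · have h1 : (fun i => differential f x ((bb.toBasis.map e.symm) i)) =
        fun i => ((bb i : LinearMap.range D) : Euc (m + 2)) := by
      funext i
      have h2 : D (e.symm (bb i)) = e (e.symm (bb i)) := rfl
      rw [e.apply_symm_apply] at h2
      rw [Module.Basis.map_apply, OrthonormalBasis.coe_toBasis]
      exact h2
    rw [h1]
    exact bb.orthonormal.comp_linearIsometry (LinearMap.range D).subtypeₗᵢ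

/-- The basis used in the definition of the Gauss map. -/
theorem gaussMap_spec (hm : 0 < m) (o : ManifoldOrientation m S)
    {f : S → Euc (m + 2)} {x : S} (himm : Function.Injective (differential (m := m) f x)) :
    ∃ ε : Module.Basis (Fin m) ℝ (TangentSpace (𝓡 m) x),
      ε.orientation = o.at_point x ∧ Orthonormal ℝ (fun i => differential f x (ε i)) ∧
      gaussMap o f x = exteriorPower.ιMulti ℝ m (fun i => differential f x (ε i)) := by
  have h := exists_oriented_orthonormal hm o himm
  exact ⟨h.choose, h.choose_spec.1, h.choose_spec.2, by rw [gaussMap, dif_pos h]⟩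

theorem gaussMap_mem (hm : 0 < m) (o : ManifoldOrientation m S)
    {f : S → Euc (m + 2)} {x : S} (himm : Function.Injective (differential (m := m) f x)) :
    gaussMap o f x ∈ grassmannian m := by
  obtain ⟨ε, -, h1, h2⟩ := gaussMap_spec hm o himm
  exact ⟨_, h1, h2.symm⟩

/-- This supplies the frozen-frame identity at all points and times, for any tangent vector and
independently of the basis chosen in `gaussMap`. -/
theorem gaussMap_cramer (hm : 0 < m) (o : ManifoldOrientation m S)
    {f : S → Euc (m + 2)} {x : S} (himm : Function.Injective (differential (m := m) f x))
    (u : TangentSpace (𝓡 m) x) (e : Fin m → Euc (m + 2)) (ν : Euc (m + 2)) :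
    inner ℝ (differential f x u) ν *
        inner ℝ (gaussMap o f x) (exteriorPower.ιMulti ℝ m e) =
      ∑ j, inner ℝ (differential f x u) (e j) *
        (inner ℝ (gaussMap o f x) (exteriorPower.ιMulti ℝ m (Function.update e j ν)) : ℝ) := by
  obtain ⟨ε, -, -, h⟩ := gaussMap_spec hm o himm
  rw [h]
  apply wedge_cramer
  rw [← ε.sum_repr u, map_sum]
  refine Submodule.sum_mem _ fun i _ => ?_
  rw [map_smul]
  exact Submodule.smul_mem _ _ (Submodule.subset_span ⟨i, rfl⟩)

/-- The Gauss map computed from an arbitrary basis of the tangent space. -/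
theorem wedge_differential_eq (hm : 0 < m) (o : ManifoldOrientation m S)
    {f : S → Euc (m + 2)} {x : S} (himm : Function.Injective (differential (m := m) f x))
    (β : Module.Basis (Fin m) ℝ (TangentSpace (𝓡 m) x)) :
    ∃ d : ℝ, d ≠ 0 ∧ (0 < d ↔ β.orientation = o.at_point x) ∧
      exteriorPower.ιMulti ℝ m (fun i => differential f x (β i)) = d • gaussMap o f x := by
  obtain ⟨ε, h1, -, h⟩ := gaussMap_spec hm o himm
  refine ⟨ε.det β, (ε.isUnit_det β).ne_zero, ?_, ?_⟩
  · rw [← h1, ← Module.Basis.orientation_eq_iff_det_pos, eq_comm]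
  · rw [h, Module.Basis.det_apply, ← Matrix.det_transpose, ← wedge_linear_combination]
    congr 1
    funext i
    conv_lhs => rw [← ε.sum_repr (β i), map_sum]
    refine Finset.sum_congr rfl fun j _ => ?_
    rw [map_smul]
    rfl

/-- The wedge of any basis is a nonzero multiple of the unit vector `gaussMap`, with sign given by
the orientation `σ`. This replaces the pointwise choice of an orthonormal basis by a formula that is
visibly smooth. -/
theorem gaussMap_eq_smul_wedge (hm : 0 < m) (o : ManifoldOrientation m S)
    {f : S → Euc (m + 2)} {x : S} (himm : Function.Injective (differential (m := m) f x))
    (β : Module.Basis (Fin m) ℝ (TangentSpace (𝓡 m) x)) {σ : ℝ}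
    (hσ : σ = 1 ∧ β.orientation = o.at_point x ∨ σ = -1 ∧ β.orientation ≠ o.at_point x) :
    exteriorPower.ιMulti ℝ m (fun i => differential f x (β i)) ≠ 0 ∧
    gaussMap o f x = (σ * ‖exteriorPower.ιMulti ℝ m (fun i => differential f x (β i))‖⁻¹) •
      exteriorPower.ιMulti ℝ m (fun i => differential f x (β i)) := by
  obtain ⟨d, hd, hpos, h⟩ := wedge_differential_eq hm o himm β
  have hnorm := norm_of_mem_grassmannian (gaussMap_mem hm o himm)
  have hn : ‖exteriorPower.ιMulti ℝ m (fun i => differential f x (β i))‖ = |d| := by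
    rw [h, norm_smul, hnorm, mul_one, Real.norm_eq_abs]
  refine ⟨fun h0 => ?_, ?_⟩
  · rw [h0, norm_zero, eq_comm, abs_eq_zero] at hn
    exact hd hn
  rw [hn, h, smul_smul]
  suffices hs : σ * |d|⁻¹ * d = 1 by rw [hs, one_smul]
  rcases hσ with ⟨rfl, hσ⟩ | ⟨rfl, hσ⟩
  · rw [abs_of_pos (hpos.2 hσ)]
    field_simp
  · have : d < 0 := lt_of_le_of_ne (not_lt.1 fun h => hσ (hpos.1 h)) hd
    rw [abs_of_neg this]
    field_simp

/-- The orientation of the coordinate frame, relative to that of the manifold, is locally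
constant. -/
theorem coordBasis_orientation (o : ManifoldOrientation m S) (x : S) :
    ∃ σ : ℝ, ∃ N : Set (Euc m), IsOpen N ∧ chartPt x ∈ N ∧ N ⊆ (extChartAt (𝓡 m) x).target ∧
      ∀ y ∈ N, ∀ hy : y ∈ (extChartAt (𝓡 m) x).target,
        σ = 1 ∧ (coordBasis x hy).orientation = o.at_point _ ∨
        σ = -1 ∧ (coordBasis x hy).orientation ≠ o.at_point _ := by
  obtain ⟨o₀, ho⟩ := o.locally_constant x
  have ht : Filter.Tendsto (extChartAt (𝓡 m) x).symm (𝓝 (chartPt x)) (𝓝 x) := by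
    have := continuousAt_extChartAt_symm (I := 𝓡 m) x
    rwa [ContinuousAt, extChartAt_to_inv] at this
  have hN := (ht.eventually ho).and ((isOpen_chart_target (m := m) x).mem_nhds (chartPt_mem x))
  obtain ⟨N, hN1, hN2, hN3⟩ := eventually_nhds_iff.1 hN
  classical
  let e := (EuclideanSpace.basisFun (Fin m) ℝ).toBasis
  refine ⟨if e.orientation = o₀ then 1 else -1, N, hN2, hN3, fun y hy => (hN1 y hy).2,
    fun y hyN hy => ?_⟩
  obtain ⟨hx, hmap⟩ := (hN1 y hyN).1
  set Φ := ((trivializationAt (Euc m) (TangentSpace (𝓡 m) : S → Type _)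
    x).continuousLinearEquivAt ℝ ((extChartAt (𝓡 m) x).symm y) hx).toLinearEquiv with hΦ
  have hs : (extChartAt (𝓡 m) x).symm y ∈ (chartAt (Euc m) x).source := by
    rw [← extChartAt_source (𝓡 m)]
    exact (extChartAt (𝓡 m) x).map_target hy
  -- On fibres the trivialization is the derivative of the chart, so it carries the coordinate frame
  -- to the standard basis.
  have h1 : (coordBasis x hy).map Φ = e := by
    refine Module.Basis.eq_of_apply_eq fun i => ?_
    rw [Module.Basis.map_apply, coordBasis_apply]
    have h2 : Φ (coordVec x i y) = (trivializationAt (Euc m) (TangentSpace (𝓡 m) : S → Type _)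
        x).continuousLinearMapAt ℝ ((extChartAt (𝓡 m) x).symm y) (coordVec x i y) := by
      rw [← Bundle.Trivialization.coe_continuousLinearEquivAt_eq _ hx]
      rfl
    rw [h2, TangentBundle.continuousLinearMapAt_trivializationAt hs]
    have h3 := mfderiv_extChartAt_comp_mfderivWithin_extChartAt_symm (I := 𝓡 m) hy
    rw [ModelWithCorners.range_eq_univ, mfderivWithin_univ] at h3
    have h4 := congrArg (fun L : Euc m →L[ℝ] Euc m => L (EuclideanSpace.single i 1)) h3
    refine h4.trans ?_
    rw [OrthonormalBasis.coe_toBasis, EuclideanSpace.basisFun_apply]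
    rfl
  have h5 : (coordBasis x hy).orientation = o.at_point _ ↔ e.orientation = o₀ := by
    rw [← h1, Module.Basis.orientation_map, ← hmap]
    exact (Equiv.apply_eq_iff_eq _).symm
  by_cases h : e.orientation = o₀
  · exact Or.inl ⟨if_pos h, h5.2 h⟩
  · exact Or.inr ⟨if_neg h, fun h' => h (h5.1 h')⟩

end GaussMap

/-! ### Smoothness of the Gauss map and its tension field in a chart. -/

section Flow

variable {m : ℕ} {S : Type*} [TopologicalSpace S] [ChartedSpace (Euc m) S]
  {T : ℝ} {F : ℝ → S → Euc (m + 2)}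

theorem IsImmersionFamily.contMDiff_slice (hF : IsImmersionFamily (m := m) T F) {t : ℝ}
    (ht : t ∈ Icc 0 T) : ContMDiff (𝓡 m) 𝓘(ℝ, Euc (m + 2)) ∞ (F t) := by
  rw [← contMDiffOn_univ]
  exact hF.smooth.comp (contMDiff_const.prodMk contMDiff_id).contMDiffOn
    fun x _ => ⟨ht, mem_univ x⟩

variable [IsManifold (𝓡 m) ∞ S]

theorem IsImmersionFamily.contDiffOn_chart (hF : IsImmersionFamily (m := m) T F) (x : S) :
    ContDiffOn ℝ ∞ (fun p : ℝ × Euc m => F p.1 ((extChartAt (𝓡 m) x).symm p.2))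
      (Icc 0 T ×ˢ (extChartAt (𝓡 m) x).target) := by
  rw [← contMDiffOn_iff_contDiffOn]
  have h1 : ContMDiffOn 𝓘(ℝ, ℝ × Euc m) (𝓘(ℝ, ℝ).prod (𝓡 m)) ∞
      (fun p : ℝ × Euc m => (p.1, (extChartAt (𝓡 m) x).symm p.2))
      (Icc 0 T ×ˢ (extChartAt (𝓡 m) x).target) :=
    contDiff_fst.contMDiff.contMDiffOn.prodMk
      ((contMDiffOn_extChartAt_symm x).comp contDiff_snd.contMDiff.contMDiffOn fun p hp => hp.2)
  exact hF.smooth.comp h1 fun p hp => ⟨hp.1, mem_univ _⟩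

/-- The Gauss map is smooth in a suitable chart. -/
theorem contDiffOn_gaussMap_chart (hm : 0 < m) (hT : 0 < T) (o : ManifoldOrientation m S)
    (hF : IsImmersionFamily (m := m) T F) (x : S) :
    ∃ N : Set (Euc m), IsOpen N ∧ chartPt x ∈ N ∧ N ⊆ (extChartAt (𝓡 m) x).target ∧
      ContDiffOn ℝ ∞ (fun p : ℝ × Euc m =>
        gaussMap o (F p.1) ((extChartAt (𝓡 m) x).symm p.2)) (Icc 0 T ×ˢ N) := by
  obtain ⟨σ, N, hNo, hxN, hNt, hσ⟩ := coordBasis_orientation o x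
  refine ⟨N, hNo, hxN, hNt, ?_⟩
  set f : ℝ × Euc m → Euc (m + 2) := fun p => F p.1 ((extChartAt (𝓡 m) x).symm p.2) with hf
  have hfs : ContDiffOn ℝ ∞ f (Icc 0 T ×ˢ N) :=
    (hF.contDiffOn_chart x).mono (prod_mono le_rfl hNt)
  -- The coordinate vectors are written through the derivative within the slab, which makes them
  -- jointly smooth in time and space up to the ends of the interval.
  set v : ℝ × Euc m → Fin m → Euc (m + 2) := fun p i =>
    fderivWithin ℝ f (Icc 0 T ×ˢ N) p (0, EuclideanSpace.single i 1) with hv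
  have hvs : ContDiffOn ℝ ∞ v (Icc 0 T ×ˢ N) := by
    rw [contDiffOn_pi]
    intro i
    exact (hfs.fderivWithin (uniqueDiffOn_slab hT hNo) le_rfl).clm_apply contDiffOn_const
  have hw : ContDiffOn ℝ ∞ (fun p => wedgeL m (v p)) (Icc 0 T ×ˢ N) :=
    (wedgeL m).contDiff.comp_contDiffOn hvs
  have key : ∀ p ∈ Icc 0 T ×ˢ N, wedgeL m (v p) ≠ 0 ∧
      gaussMap o (F p.1) ((extChartAt (𝓡 m) x).symm p.2) =
        (σ * ‖wedgeL m (v p)‖⁻¹) • wedgeL m (v p) := by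
    rintro ⟨t, y⟩ ⟨ht, hy⟩
    have h1 := gaussMap_eq_smul_wedge hm o (hF.immersion t ht _) (coordBasis x (hNt hy))
      (hσ y hy (hNt hy))
    have h2 : (fun i => differential (F t) ((extChartAt (𝓡 m) x).symm y)
        (coordBasis x (hNt hy) i)) = v (t, y) := by
      funext i
      rw [coordBasis_apply, differential_coordVec (hF.contMDiff_slice ht) x (hNt hy)]
      exact coordDeriv_time_slice hNo hfs ht hy i
    rw [h2] at h1
    exact h1
  refine ContDiffOn.congr ?_ fun p hp => (key p hp).2
  exact (contDiffOn_const.mul ((hw.norm ℝ fun p hp => (key p hp).1).inv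
    fun p hp => norm_ne_zero_iff.2 (key p hp).1)).smul hw

theorem contMDiffOn_gaussMap (hm : 0 < m) (hT : 0 < T) (o : ManifoldOrientation m S)
    (hF : IsImmersionFamily (m := m) T F) :
    ContMDiffOn (𝓘(ℝ, ℝ).prod (𝓡 m)) 𝓘(ℝ, MVec m) ∞
      (fun p : ℝ × S => gaussMap o (F p.1) p.2) (Icc 0 T ×ˢ univ) := by
  rintro ⟨t, x⟩ ⟨ht, -⟩
  obtain ⟨N, hNo, hxN, hNt, hN⟩ := contDiffOn_gaussMap_chart hm hT o hF x
  have hopen : IsOpen ((extChartAt (𝓡 m) x).source ∩ extChartAt (𝓡 m) x ⁻¹' N) :=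
    (continuousOn_extChartAt x).isOpen_inter_preimage (isOpen_extChartAt_source x) hNo
  set V := (extChartAt (𝓡 m) x).source ∩ extChartAt (𝓡 m) x ⁻¹' N with hV
  have hxV : x ∈ V := ⟨mem_extChartAt_source x, hxN⟩
  have h1 : ContMDiffOn (𝓘(ℝ, ℝ).prod (𝓡 m)) 𝓘(ℝ, ℝ × Euc m) ∞
      (fun p : ℝ × S => (p.1, extChartAt (𝓡 m) x p.2)) (Icc 0 T ×ˢ V) := by
    refine contMDiffOn_fst.prodMk_space ((contMDiffOn_extChartAt (x := x)).comp contMDiffOn_snd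
      fun p hp => ?_)
    rw [← extChartAt_source (𝓡 m)]
    exact hp.2.1
  have h2 : ContMDiffOn (𝓘(ℝ, ℝ).prod (𝓡 m)) 𝓘(ℝ, MVec m) ∞
      (fun p : ℝ × S => gaussMap o (F p.1) p.2) (Icc 0 T ×ˢ V) := by
    refine (hN.contMDiffOn.comp h1 fun p hp => ⟨hp.1, hp.2.2⟩).congr fun p hp => ?_
    simp only [Function.comp_apply]
    rw [(extChartAt (𝓡 m) x).left_inv hp.2.1]
  refine (h2 (t, x) ⟨ht, hxV⟩).mono_of_mem_nhdsWithin ?_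
  refine mem_nhdsWithin.2 ⟨univ ×ˢ V, isOpen_univ.prod hopen, ⟨mem_univ _, hxV⟩, ?_⟩
  rintro ⟨s, z⟩ ⟨⟨-, hz⟩, ⟨hs, -⟩⟩
  exact ⟨hs, hz⟩

/-- Along the `E_jα` the tension field becomes an expression in flat derivatives, the form required
by `hasDerivWithinAt_gauss_of_flow`. -/
theorem inner_frameE_tensionField {f : S → Euc (m + 2)}
    (hf : ContMDiff (𝓡 m) 𝓘(ℝ, Euc (m + 2)) ∞ f) (ρ : S → MVec m) (x : S)
    (b : OrthonormalBasis (Fin (m + 2)) ℝ (Euc (m + 2)))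
    (hb : exteriorPower.ιMulti ℝ m (fun i => b (Fin.castAdd 2 i)) = ρ x) (j : Fin m)
    (α : Fin 2) :
    inner ℝ (frameE b j α) (tensionField (m := m) (inducedMetric f) ρ x) =
      ∑ k, ∑ l, (gramMat (inChart x f) (chartPt (m := m) x))⁻¹ k l *
        ((inner ℝ (coordDeriv k (coordDeriv l (inChart x ρ)) (chartPt x)) (frameE b j α) : ℝ) -
          ∑ d, tangentCoeff (inChart x f) (chartPt x) d k l *
            inner ℝ (coordDeriv d (inChart x ρ) (chartPt x)) (frameE b j α)) := by
  rw [tensionField, inner_sum]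
  refine Finset.sum_congr rfl fun k _ => ?_
  rw [inner_sum]
  refine Finset.sum_congr rfl fun l _ => ?_
  refine (real_inner_smul_right (F := MVec m) _ _ _).trans ?_
  rw [metricMatrix_inducedMetric hf x (chartPt_mem x)]
  congr 1
  refine (inner_sub_right (𝕜 := ℝ) (E := MVec m) _ _ _).trans ?_
  rw [inner_frameE_starProjection b hb, real_inner_comm]
  congr 1
  refine (inner_sum (𝕜 := ℝ) (E := MVec m) _ _ _).trans (Finset.sum_congr rfl fun d _ => ?_)
  refine (real_inner_smul_right (F := MVec m) _ _ _).trans ?_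
  rw [christoffel_inducedMetric hf, real_inner_comm]

end Flow

theorem theorem1p1 (m : ℕ) (hm : 0 < m) (S : Type*) [TopologicalSpace S]
    [ChartedSpace (Euc m) S] [IsManifold (𝓡 m) ∞ S]
    (o : ManifoldOrientation m S) (ornt : Orientation ℝ (Euc (m + 2)) (Fin (m + 2)))
    (T : ℝ) (hT : 0 < T) (F : ℝ → S → Euc (m + 2)) (hF : IsImmersionFamily T F)
    (hflow : SolvesSMCF ornt o T F) :
    SolvesSchrodingerFlow ornt T (fun t => inducedMetric (F t)) (fun t => gaussMap o (F t)) := by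
  refine ⟨fun t ht x => gaussMap_mem hm o (hF.immersion t ht x),
    contMDiffOn_gaussMap hm hT o hF, fun t ht x => ?_⟩
  obtain ⟨N, hNo, hxN, hNt, hN⟩ := contDiffOn_gaussMap_chart hm hT o hF x
  have hfs := (hF.contDiffOn_chart x).mono (prod_mono (le_refl (Icc 0 T)) hNt)
  have key := hasDerivWithinAt_gauss_of_flow (ornt := ornt)
    (τ := tensionField (inducedMetric (F t)) (gaussMap o (F t)) x) hT hNo hfs hN
    (fun s hs y _ => gaussMap_mem hm o (hF.immersion s hs _))
    (fun s hs y hy => gramMat_inChart_det_ne_zero (hF.contMDiff_slice hs) (hF.immersion s hs) x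
      (hNt hy))
    (fun s hs y hy i e ν => by
      have h1 := gaussMap_cramer hm o (hF.immersion s hs _) (coordVec x i y) e ν
      rw [differential_coordVec (hF.contMDiff_slice hs) x (hNt hy)] at h1
      exact h1)
    ht
    (fun y hy => by
      have h1 := hflow t ht ((extChartAt (𝓡 m) x).symm y)
      rw [meanCurvature_chart_symm (hF.contMDiff_slice ht) (hF.immersion t ht) x (hNt hy)] at h1
      exact h1)
    hxN
    (fun b hb j α => by
      refine inner_frameE_tensionField (hF.contMDiff_slice ht) (gaussMap o (F t)) x b ?_ j α
      have h1 := hb.2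
      simp only [chart_symm_chartPt] at h1
      exact h1)
  simp only [chart_symm_chartPt] at key
  exact key
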